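/- Let $\mathcal P$ be the finite-dimensional real vector space, with its usual topology, of quartic forms $P$ in $X_0,\dots,X_3$ with real coefficients (equivalently, quartic forms on $\mathbb C^4$ with $P(\bar z)=\overline{P(z)}$). For $P\in\mathcal P$ let $H_P\subset\mathbb{CP}^3$ be the locus $P=0$ and let $\Sigma_P\subset H_P$ be the singular locus $P=dP=0$. Let $\mathcal O\subset\mathcal P$ be the set of $P$ with $\Sigma_P=\emptyset$, and let $\mathcal T\subset\mathcal P$ be the set of $P$ whose real locus $H_P\cap\mathbb{RP}^3$ contains a smoothly embedded $2$-torus that is disjoint from $\Sigma_P$. Call a subset of $\mathbb{RP}^3$ contractible in $\mathbb{RP}^3$ if its inclusion is null-homotopic. 1. The quartic $P=X_0^4+X_1^4-X_2^4-X_3^4$ lies in $\mathcal O\cap\mathcal T$; its real locus is a $2$-torus that is not contractible in $\mathbb{RP}^3$. 2. For all real $0<r_1<r_2$ the quartic $R=\bigl(X_0^2+X_1^2-r_1(X_2^2+X_3^2)\bigr)\bigl(X_0^2+X_1^2-r_2(X_2^2+X_3^2)\bigr)$ lies in $\mathcal T$. Its real locus is the union of two disjoint $2$-tori, neither of which is contractible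 in $\mathbb{RP}^3$, and $\Sigma_R$ is the union of the four lines $\{[a,(-1)^m ia,b,(-1)^n ib] : [a,b]\in\mathbb{CP}^1\}$, $m,n\in\{0,1\}$, which have no real points. 3. For all real $0<\epsilon<1$ the quartic $Q=(X_1^2+X_2^2-X_0^2)^2+X_3^4-\epsilon X_0^4$ lies in $\mathcal T$. Its real locus is a $2$-torus that is contractible in $\mathbb{RP}^3$, and $\Sigma_Q$ consists of the two nonreal points $[0,1,\pm i,0]$. 4. The set $\mathcal O\cap\mathcal T$ has at least three connected components. More precisely, there are quartics $R',Q'\in\mathcal O\cap\mathcal T$ such that the real locus of $R'$ is the union of two disjoint $2$-tori that are not contractible in $\mathbb{RP}^3$, the real locus of $Q'$ is a $2$-torus that is contractible in $\mathbb{RP}^3$, and the quartic $P$ of part 1, $R'$ and $Q'$ lie in three different connected components of $\mathcal O\cap\mathcal T$. -/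

import Mathlib

open scoped LinearAlgebra.Projectivization ContDiff ComplexConjugate

noncomputable section

namespace RealQuartics

/-- Complex projective 3-space. -/
abbrev CP3 : Type := ℙ ℂ (Fin 4 → ℂ)

/-- Real projective 3-space. -/
abbrev RP3 : Type := ℙ ℝ (Fin 4 → ℝ)

/-- `RP3` carries the quotient topology of `ℝ⁴ \ {0}`. -/
instance : TopologicalSpace RP3 :=
  inferInstanceAs (TopologicalSpace (Quotient (projectivizationSetoid ℝ (Fin 4 → ℝ))))

/-- The coordinatewise inclusion `ℝ⁴ ⊆ ℂ⁴`. -/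
def complexify : (Fin 4 → ℝ) →ₛₗ[Complex.ofRealHom] (Fin 4 → ℂ) where
  toFun x := fun i => (x i : ℂ)
  map_add' x y := by ext i; simp
  map_smul' a x := by ext i; simp

theorem complexify_injective : Function.Injective complexify := by
  intro x y h
  ext i
  exact Complex.ofReal_injective (congrFun h i)

/-- The inclusion of `RP3` in `CP3` as the set of real points. -/
def realPoints : RP3 → CP3 :=
  Projectivization.map complexify complexify_injective

/-- The real vector space of quartic forms `P` on `ℂ⁴` with `P ∘ c = conj P`, where `c` is the
usual conjugation; these are the quartic forms with real coefficients
(see `conj_invariant_iff_real_coefficients`). -/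
abbrev Quartic : Type := ↥(MvPolynomial.homogeneousSubmodule (Fin 4) ℝ 4)

theorem conj_invariant_iff_real_coefficients (P : MvPolynomial (Fin 4) ℂ) :
    (∀ z : Fin 4 → ℂ, MvPolynomial.eval (fun i => conj (z i)) P = conj (MvPolynomial.eval z P)) ↔
      ∃ P₀ : MvPolynomial (Fin 4) ℝ, MvPolynomial.map Complex.ofRealHom P₀ = P := by
  have key : ∀ z : Fin 4 → ℂ, conj (MvPolynomial.eval z P) =
      MvPolynomial.eval (fun i => conj (z i)) (MvPolynomial.map (starRingEnd ℂ) P) := by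
    intro z
    rw [MvPolynomial.eval_map, ← MvPolynomial.coe_eval₂Hom, MvPolynomial.eval]
    simp only [MvPolynomial.coe_eval₂Hom]
    rw [MvPolynomial.eval₂_comp_left (starRingEnd ℂ)]
    rfl
  constructor
  · intro h
    have hP : MvPolynomial.map (starRingEnd ℂ) P = P := by
      apply MvPolynomial.funext
      intro z
      have h1 := h (fun i => conj (z i))
      rw [key] at h1
      simpa using h1.symm
    have : P ∈ Set.range (MvPolynomial.map (σ := Fin 4) Complex.ofRealHom) := by
      rw [MvPolynomial.mem_range_map_iff_coeffs_subset]
      intro c hc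
      obtain ⟨m, -, rfl⟩ := MvPolynomial.mem_coeffs_iff.1 hc
      have h2 := congrArg (MvPolynomial.coeff m) hP
      rw [MvPolynomial.coeff_map] at h2
      exact ⟨(MvPolynomial.coeff m P).re, Complex.conj_eq_iff_re.1 h2⟩
    exact this
  · rintro ⟨P₀, rfl⟩ z
    have hc : (starRingEnd ℂ).comp Complex.ofRealHom = Complex.ofRealHom :=
      RingHom.ext fun x => Complex.conj_ofReal x
    rw [key, MvPolynomial.map_map, hc]

/-- The usual topology of the finite-dimensional real vector space `Quartic`: the topology of
coefficientwise convergence. -/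
instance : TopologicalSpace Quartic :=
  TopologicalSpace.induced
    (fun P (m : Fin 4 →₀ ℕ) => MvPolynomial.coeff m (P : MvPolynomial (Fin 4) ℝ)) inferInstance

/-- The complex surface `H_P` in `CP3` defined by `P = 0`. -/
def surface (P : Quartic) : Set CP3 :=
  {p | ∃ (z : Fin 4 → ℂ) (hz : z ≠ 0),
    MvPolynomial.aeval z (P : MvPolynomial (Fin 4) ℝ) = 0 ∧ p = Projectivization.mk ℂ z hz}

/-- The singular locus `Σ_P` in `CP3`, defined by `P = dP = 0`. -/
def singularLocus (P : Quartic) : Set CP3 :=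
  {p | ∃ (z : Fin 4 → ℂ) (hz : z ≠ 0),
    MvPolynomial.aeval z (P : MvPolynomial (Fin 4) ℝ) = 0 ∧
    (∀ i, MvPolynomial.aeval z (MvPolynomial.pderiv i (P : MvPolynomial (Fin 4) ℝ)) = 0) ∧
    p = Projectivization.mk ℂ z hz}

/-- The real slice `H_P ∩ RP3`, as a subset of `RP3`. -/
def realLocus (P : Quartic) : Set RP3 := realPoints ⁻¹' surface P

/-- `L` is a smoothly embedded 2-torus in `RP3`. Since `ℝ²` is simply connected, a smooth
embedding of `ℝ² / ℤ²` in `RP3` is the same, up to the choice of a lift, as a smooth map `F` from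
`ℝ²` to `ℝ⁴ \ {0}` such that `[F x] = [F y]` exactly when `x` and `y` differ by an integer vector
and such that `x ↦ [F x]` is an immersion, i.e. `F`, `∂₁F`, `∂₂F` are everywhere independent. -/
def IsTorus (L : Set RP3) : Prop :=
  ∃ (F : ℝ × ℝ → Fin 4 → ℝ) (hF : ∀ x, F x ≠ 0),
    ContDiff ℝ ∞ F ∧
    (∀ x, LinearIndependent ℝ ![F x, fderiv ℝ F x (1, 0), fderiv ℝ F x (0, 1)]) ∧
    (∀ x y, Projectivization.mk ℝ (F x) (hF x) = Projectivization.mk ℝ (F y) (hF y) ↔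
      ∃ m n : ℤ, y = x + ((m : ℝ), (n : ℝ))) ∧
    L = Set.range fun x => Projectivization.mk ℝ (F x) (hF x)

/-- `L` is contractible in the ambient space `X`: its inclusion is null-homotopic. -/
def ContractibleIn {X : Type*} [TopologicalSpace X] (L : Set X) : Prop :=
  (ContinuousMap.mk (Subtype.val : L → X) continuous_subtype_val).Nullhomotopic

/-- The set `𝒪` of real quartics with empty (complex) singular locus. -/
def smoothQuartics : Set Quartic := {P | singularLocus P = ∅}

/-- The set `𝒯` of real quartics whose real slice contains a 2-torus that is disjoint from the
singular locus. -/
def torusQuartics : Set Quartic :=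
  {P | ∃ L : Set RP3, IsTorus L ∧ L ⊆ realLocus P ∧ Disjoint (realPoints '' L) (singularLocus P)}

section Examples

open MvPolynomial

/-- `X₀⁴ + X₁⁴ - X₂⁴ - X₃⁴` -/
def fermatQuartic : Quartic :=
  ⟨X 0 ^ 4 + X 1 ^ 4 - X 2 ^ 4 - X 3 ^ 4, by
    have h (i : Fin 4) : (X i ^ 4 : MvPolynomial (Fin 4) ℝ).IsHomogeneous 4 := by
      simpa using (isHomogeneous_X ℝ i).pow 4
    exact (((h 0).add (h 1)).sub (h 2)).sub (h 3)⟩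

/-- `(X₀² + X₁² - r₁ (X₂² + X₃²)) (X₀² + X₁² - r₂ (X₂² + X₃²))` -/
def productQuartic (r₁ r₂ : ℝ) : Quartic :=
  ⟨(X 0 ^ 2 + X 1 ^ 2 - C r₁ * (X 2 ^ 2 + X 3 ^ 2)) *
      (X 0 ^ 2 + X 1 ^ 2 - C r₂ * (X 2 ^ 2 + X 3 ^ 2)), by
    have h (i : Fin 4) : (X i ^ 2 : MvPolynomial (Fin 4) ℝ).IsHomogeneous 2 := by
      simpa using (isHomogeneous_X ℝ i).pow 2
    have h' (r : ℝ) : (X 0 ^ 2 + X 1 ^ 2 - C r * (X 2 ^ 2 + X 3 ^ 2) :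
        MvPolynomial (Fin 4) ℝ).IsHomogeneous 2 :=
      ((h 0).add (h 1)).sub (((h 2).add (h 3)).C_mul r)
    exact (h' r₁).mul (h' r₂)⟩

/-- `(X₁² + X₂² - X₀²)² + X₃⁴ - ε X₀⁴` -/
def revolutionQuartic (ε : ℝ) : Quartic :=
  ⟨(X 1 ^ 2 + X 2 ^ 2 - X 0 ^ 2) ^ 2 + X 3 ^ 4 - C ε * X 0 ^ 4, by
    have h (i : Fin 4) (k : ℕ) : (X i ^ k : MvPolynomial (Fin 4) ℝ).IsHomogeneous k := by
      simpa using (isHomogeneous_X ℝ i).pow k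
    have h' : ((X 1 ^ 2 + X 2 ^ 2 - X 0 ^ 2) ^ 2 : MvPolynomial (Fin 4) ℝ).IsHomogeneous 4 :=
      (((h 1 2).add (h 2 2)).sub (h 0 2)).pow 2
    exact (h'.add (h 3 4)).sub ((h 0 4).C_mul ε)⟩

end Examples

/-- The complex line of all `[a, (-1)ᵐ i a, b, (-1)ⁿ i b]` with `[a, b]` in `CP1`. -/
def isotropicLine (m n : Fin 2) : Set CP3 :=
  {p | ∃ (a b : ℂ) (h : ![a, (-1) ^ (m : ℕ) * Complex.I * a, b,
      (-1) ^ (n : ℕ) * Complex.I * b] ≠ 0), p = Projectivization.mk ℂ _ h}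

/-- The point `[0, 1, (-1)ᵐ i, 0]`. -/
def circularPoint (m : Fin 2) : CP3 :=
  Projectivization.mk ℂ ![0, 1, (-1) ^ (m : ℕ) * Complex.I, 0]
    (fun h => by simpa using congrFun h 1)

/-- The real slice of `P` is a single 2-torus, not contractible in `RP3`. -/
def HasOneEssentialTorus (P : Quartic) : Prop :=
  IsTorus (realLocus P) ∧ ¬ ContractibleIn (realLocus P)

/-- The real slice of `P` is the union of two disjoint 2-tori, neither of them contractible
in `RP3`. -/
def HasTwoEssentialTori (P : Quartic) : Prop :=
  ∃ T₁ T₂ : Set RP3, IsTorus T₁ ∧ IsTorus T₂ ∧ Disjoint T₁ T₂ ∧ realLocus P = T₁ ∪ T₂ ∧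
    ¬ ContractibleIn T₁ ∧ ¬ ContractibleIn T₂

/-- The real slice of `P` is a single 2-torus, contractible in `RP3`. -/
def HasOneContractibleTorus (P : Quartic) : Prop :=
  IsTorus (realLocus P) ∧ ContractibleIn (realLocus P)

end RealQuartics

end

open RealQuartics

namespace RealQuartics

open Filter Topology MvPolynomial

/-! Components of `𝒪 ∩ 𝒯` are separated by two locally constant invariants of the cones `{P > 0}`
and `{P < 0}` in `ℝ⁴ \ {0}`: whether `{P > 0}` is path connected (`PosConnected P`), and whether `{P
< 0}` contains a path from a vector to its negative (`HasAntipodalPath (-P)`), that is, whether the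
negative region of RP3 contains an essential loop. The real zeros of a smooth quartic are regular,
so near each zero the positive side is a half-ball that varies little with `P`. Compactness of the
sphere turns this into stability of the path components of `{P > 0}` (`exists_finite_joinedIn`,
`eventually_joinedIn`, `eventually_not_joinedIn`), hence both invariants are locally constant.

The representatives are the Fermat quartic, a smooth quartic `smoothPairQuartic` with two nested
Clifford tori, and a smooth quartic `smoothTubeQuartic` with a torus inside an affine chart. The
first has `{P > 0}` connected, the second does not. In both, `{P < 0}` contains a projective line or
an essential circle, while for the third `{P < 0}` avoids the plane `X₀ = 0`, so no antipodal path
exists.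

The real loci are parametrized explicitly. In double polar coordinates the essential tori are graphs
`A = ρ(θ, φ) B` over the two angles (`isTorus_cliffordTorus`). The contractible ones are tubes
around a circle in the chart `X₀ = 1` with cross-section the oval `X² + Y⁴ = 1` (`IsTube.isTorus`).
A torus is essential when it carries a loop that lifts to an antipodal path: a null-homotopic
inclusion would lift continuously to `ℝ⁴ \ {0}` (`exists_isVectorLift_of_nullhomotopic`), which such
a loop forbids. A subset of an affine chart contracts by a straight-line homotopy.

The complex singular loci come from solving `P = dP = 0` directly. -/

/-- The value of a real quartic form at a real vector. -/
noncomputable def value (P : Quartic) (x : Fin 4 → ℝ) : ℝ := eval x (P : MvPolynomial (Fin 4) ℝ)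

/-- The derivative of a real quartic form at `x` in the direction `v`. -/
noncomputable def dirDeriv (P : Quartic) (x v : Fin 4 → ℝ) : ℝ :=
  ∑ i, eval x (pderiv i (P : MvPolynomial (Fin 4) ℝ)) * v i

/-- The cone of real vectors on which a quartic form is positive. -/
def posSet (P : Quartic) : Set (Fin 4 → ℝ) := {x | 0 < value P x}

/-! ### Continuity, derivatives and homogeneity of evaluation -/

theorem continuous_coeff (m : Fin 4 →₀ ℕ) :
    Continuous fun P : Quartic => coeff m (P : MvPolynomial (Fin 4) ℝ) :=
  (continuous_apply m).comp continuous_induced_dom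

theorem continuous_neg_quartic : Continuous fun P : Quartic => -P := by
  rw [continuous_induced_rng, continuous_pi_iff]
  intro m
  exact (continuous_coeff m).neg.congr fun P => by simp

/-- The exponents of degree 4 form a finite set independent of `P`, so expressions linear in `P`
become finite sums over a fixed index set with coefficients continuous in `P`. -/
theorem quartic_eq_sum (P : Quartic) : (P : MvPolynomial (Fin 4) ℝ) =
    ∑ m ∈ (Finset.univ : Finset (Fin 4)).finsuppAntidiag 4,
      C (coeff m (P : MvPolynomial (Fin 4) ℝ)) * monomial m 1 := by
  conv_lhs => rw [as_sum (P : MvPolynomial (Fin 4) ℝ)]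
  simp only [C_mul_monomial, mul_one]
  refine Finset.sum_subset ?_ ?_
  · intro m hm
    have h := P.2 (mem_support_iff.1 hm)
    rw [Finset.mem_finsuppAntidiag]
    refine ⟨?_, by simp⟩
    rw [Finsupp.weight_apply, Finsupp.sum_fintype _ _ (by simp)] at h
    simpa using h
  · intro m _ hm
    rw [notMem_support_iff.1 hm, map_zero]

theorem continuous_eval_linear (Φ : (Fin 4 → ℝ) → MvPolynomial (Fin 4) ℝ →ₗ[ℝ] ℝ)
    (hΦ : ∀ p, Continuous fun x => Φ x p) :
    Continuous fun q : Quartic × (Fin 4 → ℝ) => Φ q.2 (q.1 : MvPolynomial (Fin 4) ℝ) := by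
  have h (q : Quartic × (Fin 4 → ℝ)) : Φ q.2 (q.1 : MvPolynomial (Fin 4) ℝ) =
      ∑ m ∈ (Finset.univ : Finset (Fin 4)).finsuppAntidiag 4,
        coeff m (q.1 : MvPolynomial (Fin 4) ℝ) * Φ q.2 (monomial m 1) := by
    conv_lhs => rw [quartic_eq_sum q.1]
    simp only [map_sum, ← smul_eq_C_mul, map_smul, smul_eq_mul]
  simp only [h]
  exact continuous_finsetSum _ fun m _ =>
    ((continuous_coeff m).comp continuous_fst).mul ((hΦ _).comp continuous_snd)

theorem continuous_value : Continuous fun q : Quartic × (Fin 4 → ℝ) => value q.1 q.2 :=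
  continuous_eval_linear (fun x => (aeval x).toLinearMap) fun p => by
    simpa using MvPolynomial.continuous_eval p

theorem continuous_dirDeriv (v : Fin 4 → ℝ) :
    Continuous fun q : Quartic × (Fin 4 → ℝ) => dirDeriv q.1 q.2 v := by
  unfold dirDeriv
  refine continuous_finsetSum _ fun i _ => Continuous.mul ?_ continuous_const
  exact continuous_eval_linear
    (fun x => (aeval x).toLinearMap ∘ₗ (pderiv i).toLinearMap) fun p => by
      simpa using MvPolynomial.continuous_eval (pderiv i p)

theorem hasDerivAt_eval_line (p : MvPolynomial (Fin 4) ℝ) (x v : Fin 4 → ℝ) (t : ℝ) :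
    HasDerivAt (fun τ : ℝ => eval (x + τ • v) p) (∑ i, eval (x + t • v) (pderiv i p) * v i) t := by
  induction p using MvPolynomial.induction_on with
  | C a => simpa using hasDerivAt_const t a
  | add p q hp hq =>
    refine (hp.add hq).congr_deriv ?_ |>.congr_of_eventuallyEq (.of_forall fun τ => ?_)
    · simp [add_mul, Finset.sum_add_distrib]
    · simp
  | mul_X p j hp =>
    have h1 : HasDerivAt (fun τ : ℝ => x j + τ * v j) (v j) t := by
      simpa using ((hasDerivAt_id t).mul_const (v j)).const_add (x j)
    have h2 := hp.mul h1
    refine h2.congr_deriv ?_ |>.congr_of_eventuallyEq (.of_forall fun τ => by simp)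
    simp only [Derivation.leibniz, pderiv_X, smul_eq_mul, map_add, map_mul, eval_X, add_mul,
      Finset.sum_add_distrib]
    rw [add_comm, Finset.sum_mul]
    congr 1
    · rw [Finset.sum_eq_single j]
      · simp
      · intro b _ hb; simp [hb.symm]
      · simp
    · exact Finset.sum_congr rfl fun i _ => by simp; ring

theorem hasDerivAt_value_line (P : Quartic) (x v : Fin 4 → ℝ) (t : ℝ) :
    HasDerivAt (fun τ : ℝ => value P (x + τ • v)) (dirDeriv P (x + t • v) v) t :=
  hasDerivAt_eval_line _ x v t

/-- Stated over any algebra because it serves both real values and the change of complex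
representative in `mk_mem_realLocus`. -/
theorem aeval_smul_quartic {A : Type*} [CommRing A] [Algebra ℝ A] (P : Quartic) (c : A)
    (x : Fin 4 → A) : aeval (c • x) (P : MvPolynomial (Fin 4) ℝ) =
      c ^ 4 * aeval x (P : MvPolynomial (Fin 4) ℝ) := by
  rw [quartic_eq_sum P]
  simp only [map_sum, map_mul, aeval_C, aeval_monomial, map_one, one_mul, Finset.mul_sum]
  refine Finset.sum_congr rfl fun m hm => ?_
  rw [Finset.mem_finsuppAntidiag] at hm
  rw [Finsupp.prod_fintype _ _ (by simp), Finsupp.prod_fintype _ _ (by simp)]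
  simp only [Pi.smul_apply, smul_eq_mul, mul_pow, Finset.prod_mul_distrib,
    Finset.prod_pow_eq_pow_sum]
  rw [hm.1]
  ring

theorem value_smul (P : Quartic) (c : ℝ) (x : Fin 4 → ℝ) :
    value P (c • x) = c ^ 4 * value P x := by
  simpa only [← coe_aeval_eq_eval] using! aeval_smul_quartic P c x

theorem value_neg (P : Quartic) (x : Fin 4 → ℝ) : value P (-x) = value P x := by
  have h := value_smul P (-1) x
  norm_num at h
  exact h

theorem value_neg_quartic (P : Quartic) (x : Fin 4 → ℝ) : value (-P) x = -value P x := by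
  simp [value]

theorem smul_mem_posSet {P : Quartic} {x : Fin 4 → ℝ} (hx : x ∈ posSet P) {c : ℝ} (hc : c ≠ 0) :
    c • x ∈ posSet P := by
  have : 0 < c ^ 4 := by positivity
  simpa [posSet, value_smul, this] using hx

theorem ne_zero_of_mem_posSet {P : Quartic} {x : Fin 4 → ℝ} (hx : x ∈ posSet P) : x ≠ 0 := by
  rintro rfl
  have h := value_smul P 0 0
  rw [smul_zero] at h
  rw [posSet, Set.mem_ofPred_eq, h] at hx
  norm_num at hx

/-! ### Regular real zeros and the positive cone near them -/

/-- The real zeros of `P` away from the origin are regular points of `P`. -/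
def RealRegular (P : Quartic) : Prop :=
  ∀ x : Fin 4 → ℝ, x ≠ 0 → value P x = 0 → ∃ v, 0 < dirDeriv P x v

theorem aeval_complexify (p : MvPolynomial (Fin 4) ℝ) (x : Fin 4 → ℝ) :
    aeval (complexify x) p = ((eval x p : ℝ) : ℂ) := by
  have h := aeval_algebraMap_apply (B := ℂ) x p
  simpa using! h

/-- A real zero at which no directional derivative is positive has zero gradient, and is then a real
point of the complex singular locus. -/
theorem realRegular_of_smooth {P : Quartic} (hP : P ∈ smoothQuartics) : RealRegular P := by
  intro x hx hPx
  by_contra! hv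
  have hz : complexify x ≠ 0 := fun h => hx (complexify_injective (by simpa using h))
  have hmem : Projectivization.mk ℂ (complexify x) hz ∈ singularLocus P := by
    refine ⟨_, hz, ?_, fun i => ?_, rfl⟩
    · rw [aeval_complexify]
      exact_mod_cast hPx
    · rw [aeval_complexify]
      -- In the direction `∂ᵢP(x) eᵢ` the derivative is `(∂ᵢP(x))²`, so it can be nonpositive only
      -- if `∂ᵢP(x) = 0`.
      have h := hv (Pi.single i (eval x (pderiv i (P : MvPolynomial (Fin 4) ℝ))))
      rw [dirDeriv, Finset.sum_eq_single i (fun b _ hb => by simp [hb])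
        (by simp)] at h
      rw [Pi.single_eq_same] at h
      have h0 := mul_self_eq_zero.1 (le_antisymm h (mul_self_nonneg _))
      exact_mod_cast h0
  rw [show singularLocus P = ∅ from hP] at hmem
  exact hmem

theorem RealRegular.neg {P : Quartic} (hP : RealRegular P) : RealRegular (-P) := by
  intro x hx h
  rw [value_neg_quartic, neg_eq_zero] at h
  obtain ⟨v, hv⟩ := hP x hx h
  refine ⟨-v, ?_⟩
  simpa [dirDeriv] using hv

/-- Positivity is pushed forward along a direction in which the form increases. -/
theorem value_pos_of_dirDeriv_pos {P : Quartic} {y v : Fin 4 → ℝ} {t : ℝ}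
    (hd : ∀ τ ∈ Set.Icc 0 t, 0 < dirDeriv P (y + τ • v) v) {τ : ℝ} (hτ : τ ∈ Set.Icc 0 t)
    (hne : 0 < τ ∨ 0 < value P y) (hy : 0 ≤ value P y) : 0 < value P (y + τ • v) := by
  have hmono : StrictMonoOn (fun τ : ℝ => value P (y + τ • v)) (Set.Icc 0 t) := by
    refine strictMonoOn_of_deriv_pos (convex_Icc _ _)
      (fun s _ => (hasDerivAt_value_line P y v s).continuousAt.continuousWithinAt) fun s hs => ?_
    rw [(hasDerivAt_value_line P y v s).deriv]
    exact hd s (interior_subset hs)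
  have h0 : (0 : ℝ) ∈ Set.Icc 0 t := ⟨le_rfl, hτ.1.trans hτ.2⟩
  rcases hτ.1.eq_or_lt with rfl | h
  · simpa using hne
  · have := hmono h0 hτ h
    simp only [zero_smul, add_zero] at this
    exact hy.trans_lt this

/-- The local form of stability: near `(P, x)` all positive points lie in one path component, with a
common base point `z`. At a zero, choose `v` with `∂ᵥP > 0`; this persists near `(P, x)`, so every
nearby positive point can be pushed a fixed distance along `v` while staying positive, and lands in
a ball around `z = x + (δ/2)v` on which nearby forms are positive. Where `P(x) > 0`, take `z = x`
and a ball. -/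
theorem exists_joinedIn_nearby {P : Quartic} (hP : RealRegular P) {x : Fin 4 → ℝ} (hx : x ≠ 0)
    (hPx : 0 ≤ value P x) : ∃ z ∈ posSet P, ∀ᶠ q : Quartic × (Fin 4 → ℝ) in 𝓝 (P, x),
      q.2 ∈ posSet q.1 → JoinedIn (posSet q.1) q.2 z := by
  rcases hPx.eq_or_lt' with h | h
  · obtain ⟨v, hv⟩ := hP x hx h
    have hD : ∀ᶠ q : Quartic × (Fin 4 → ℝ) in 𝓝 (P, x), 0 < dirDeriv q.1 q.2 v :=
      continuousAt_const.eventually_lt (continuous_dirDeriv v).continuousAt hv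
    rw [nhds_prod_eq, eventually_prod_iff] at hD
    obtain ⟨p₁, hp₁, p₂, hp₂, hD⟩ := hD
    obtain ⟨R, hR, hball⟩ := Metric.eventually_nhds_iff_ball.1 hp₂
    have hlim : Tendsto (fun τ : ℝ => ‖τ • v‖) (𝓝 0) (𝓝 0) := by
      have : Continuous fun τ : ℝ => ‖τ • v‖ := by fun_prop
      simpa using this.tendsto 0
    obtain ⟨δ, hδ, hsmall⟩ :=
      Metric.eventually_nhds_iff_ball.1 (hlim.eventually_lt_const (half_pos hR))
    -- Half of `R` pays for the distance from `x`, half for the displacement; `δ / 2` keeps the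
    -- closed interval of times inside the open ball of radius `δ`.
    have hshift : ∀ y ∈ Metric.ball x (R / 2), ∀ τ ∈ Set.Icc 0 (δ / 2),
        y + τ • v ∈ Metric.ball x R := by
      intro y hy τ hτ
      have h1 := hsmall τ (by
        rw [Metric.mem_ball, Real.dist_eq, sub_zero, abs_of_nonneg hτ.1]; linarith [hτ.2])
      rw [Metric.mem_ball, dist_eq_norm] at hy ⊢
      calc ‖y + τ • v - x‖ = ‖(y - x) + τ • v‖ := by congr 1; abel
        _ ≤ ‖y - x‖ + ‖τ • v‖ := norm_add_le _ _
        _ < R := by linarith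
    have hmem : δ / 2 ∈ Set.Icc 0 (δ / 2) := ⟨by positivity, le_rfl⟩
    have hz : 0 < value P (x + (δ / 2) • v) :=
      value_pos_of_dirDeriv_pos
        (fun τ hτ => hD hp₁.self_of_nhds (hball _ (hshift x (by simpa using hR) τ hτ))) hmem
        (Or.inl (by positivity)) h.ge
    refine ⟨x + (δ / 2) • v, hz, ?_⟩
    have hV : ∀ᶠ q : Quartic × (Fin 4 → ℝ) in 𝓝 (P, x + (δ / 2) • v), 0 < value q.1 q.2 :=
      continuousAt_const.eventually_lt continuous_value.continuousAt hz
    rw [nhds_prod_eq, eventually_prod_iff] at hV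
    obtain ⟨p₃, hp₃, p₄, hp₄, hV⟩ := hV
    obtain ⟨r, hr, hball'⟩ := Metric.eventually_nhds_iff_ball.1 hp₄
    have h1 : ∀ᶠ q : Quartic × (Fin 4 → ℝ) in 𝓝 (P, x), (p₁ q.1 ∧ p₃ q.1) ∧
        (q.2 ∈ Metric.ball x (R / 2) ∧ q.2 ∈ Metric.ball x r) := by
      rw [nhds_prod_eq]
      exact (hp₁.and hp₃).prod_mk (Eventually.and (Metric.ball_mem_nhds x (half_pos hR))
        (Metric.ball_mem_nhds x hr))
    filter_upwards [h1] with q hq hpos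
    obtain ⟨⟨hq1, hq3⟩, hq2, hq4⟩ := hq
    refine JoinedIn.trans (y := q.2 + (δ / 2) • v) ?_ ?_
    · refine JoinedIn.of_segment_subset ?_
      rintro w hw
      rw [segment_eq_image'] at hw
      obtain ⟨s, hs, rfl⟩ := hw
      have : q.2 + s • (q.2 + (δ / 2) • v - q.2) = q.2 + (s * (δ / 2)) • v := by
        rw [add_sub_cancel_left, smul_smul]
      simp only [this]
      refine value_pos_of_dirDeriv_pos (t := δ / 2)
        (fun τ hτ => hD hq1 (hball _ (hshift _ hq2 τ hτ)))
        ⟨mul_nonneg hs.1 hmem.1, mul_le_of_le_one_left hmem.1 hs.2⟩ (Or.inr hpos) (le_of_lt hpos)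
    · refine JoinedIn.of_segment_subset fun w hw => hV hq3 (hball' w ?_)
      refine (convex_ball _ r).segment_subset ?_ (Metric.mem_ball_self hr) hw
      simpa [Metric.mem_ball, dist_eq_norm] using hq4
  · refine ⟨x, h, ?_⟩
    have hV : ∀ᶠ q : Quartic × (Fin 4 → ℝ) in 𝓝 (P, x), 0 < value q.1 q.2 :=
      continuousAt_const.eventually_lt continuous_value.continuousAt h
    rw [nhds_prod_eq, eventually_prod_iff] at hV
    obtain ⟨p₃, hp₃, p₄, hp₄, hV⟩ := hV
    obtain ⟨r, hr, hball'⟩ := Metric.eventually_nhds_iff_ball.1 hp₄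
    have h1 : ∀ᶠ q : Quartic × (Fin 4 → ℝ) in 𝓝 (P, x), p₃ q.1 ∧ q.2 ∈ Metric.ball x r := by
      rw [nhds_prod_eq]
      exact hp₃.prod_mk (Metric.ball_mem_nhds x hr)
    filter_upwards [h1] with q hq _
    refine JoinedIn.of_segment_subset fun w hw => hV hq.1 (hball' w ?_)
    exact (convex_ball _ r).segment_subset hq.2 (Metric.mem_ball_self hr) hw

/-- Every zero of a regular form is a limit of points where the form is positive. -/
theorem mem_closure_posSet {P : Quartic} (hP : RealRegular P) {x : Fin 4 → ℝ} (hx : x ≠ 0)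
    (h : 0 ≤ value P x) : x ∈ closure (posSet P) := by
  rcases h.eq_or_lt with h0 | h0
  · obtain ⟨v, hv⟩ := hP x hx h0.symm
    have hline : Continuous fun τ : ℝ => x + τ • v := by fun_prop
    have hD : ∀ᶠ τ : ℝ in 𝓝 0, 0 < dirDeriv P (x + τ • v) v := by
      have h0 := hline.tendsto 0
      rw [zero_smul, add_zero] at h0
      have h1 : Tendsto (fun y => dirDeriv P y v) (𝓝 x) (𝓝 (dirDeriv P x v)) :=
        (continuous_dirDeriv v).comp (Continuous.prodMk_right P) |>.tendsto x
      exact h0.eventually (h1.eventually_const_lt hv)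
    obtain ⟨δ, hδ, hb⟩ := Metric.eventually_nhds_iff_ball.1 hD
    have hlim : Tendsto (fun τ : ℝ => x + τ • v) (𝓝[>] 0) (𝓝 x) := by
      have := hline.tendsto 0
      rw [zero_smul, add_zero] at this
      exact this.mono_left nhdsWithin_le_nhds
    refine mem_closure_of_tendsto hlim ?_
    filter_upwards [Ioo_mem_nhdsGT hδ] with τ hτ
    refine value_pos_of_dirDeriv_pos (t := τ) (fun s hs => hb s ?_) ⟨hτ.1.le, le_rfl⟩
      (Or.inl hτ.1) h
    rw [Metric.mem_ball, Real.dist_eq, sub_zero, abs_of_nonneg hs.1]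
    exact hs.2.trans_lt hτ.2
  · exact subset_closure h0

theorem joinedIn_smul {P : Quartic} {x : Fin 4 → ℝ} (hx : x ∈ posSet P) {c : ℝ} (hc : 0 < c) :
    JoinedIn (posSet P) x (c • x) := by
  refine JoinedIn.of_segment_subset fun w hw => ?_
  rw [segment_eq_image] at hw
  obtain ⟨s, hs, rfl⟩ := hw
  have : (1 - s) • x + s • c • x = ((1 - s) + s * c) • x := by rw [add_smul, smul_smul]
  simp only [this]
  refine smul_mem_posSet hx (ne_of_gt ?_)
  rcases hs.1.eq_or_lt with rfl | h
  · norm_num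
  · have := mul_pos h hc
    linarith [hs.2]

/-! ### Stability of the path components of the positive cone -/

/-- The norm on `Fin 4 → ℝ` is the sup norm; only compactness of its unit sphere and invariance of
the cone under scaling matter. -/
theorem normalize_mem_sphere {x : Fin 4 → ℝ} (hx : x ≠ 0) :
    ‖x‖⁻¹ • x ∈ Metric.sphere (0 : Fin 4 → ℝ) 1 := by
  simp [norm_smul, hx]

/-- One finite set of base points meets every path component of `{P' > 0}` for all `P'` near `P`.
The sphere is covered by the neighbourhoods of `exists_joinedIn_nearby`, together with
neighbourhoods on which `P' < 0`, which need no base point; scaling extends this to the cone. -/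
theorem exists_finite_joinedIn {P : Quartic} (hP : RealRegular P) :
    ∃ Z ⊆ posSet P, Z.Finite ∧ ∀ᶠ P' in 𝓝 P, ∀ y ∈ posSet P',
      ∃ z ∈ Z, JoinedIn (posSet P') y z := by
  have key : ∃ Z ⊆ posSet P, Z.Finite ∧ ∀ᶠ P' in 𝓝 P,
      ∀ y ∈ Metric.sphere (0 : Fin 4 → ℝ) 1, y ∈ posSet P' →
      ∃ z ∈ Z, JoinedIn (posSet P') y z := by
    refine (isCompact_sphere (0 : Fin 4 → ℝ) 1).induction_on
      (p := fun s => ∃ Z ⊆ posSet P, Z.Finite ∧ ∀ᶠ P' in 𝓝 P, ∀ y ∈ s, y ∈ posSet P' →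
        ∃ z ∈ Z, JoinedIn (posSet P') y z) ⟨∅, Set.empty_subset _, Set.finite_empty, by simp⟩ ?_ ?_ ?_
    · rintro s t hst ⟨Z, hZP, hZ, h⟩
      exact ⟨Z, hZP, hZ, h.mono fun P' h y hy => h y (hst hy)⟩
    · rintro s t ⟨Z, hZP, hZ, h⟩ ⟨Z', hZP', hZ', h'⟩
      refine ⟨Z ∪ Z', Set.union_subset hZP hZP', hZ.union hZ', ?_⟩
      filter_upwards [h, h'] with P' h h' y hy hpos
      rcases hy with hy | hy
      · obtain ⟨z, hz, hj⟩ := h y hy hpos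
        exact ⟨z, Or.inl hz, hj⟩
      · obtain ⟨z, hz, hj⟩ := h' y hy hpos
        exact ⟨z, Or.inr hz, hj⟩
    · intro x hx
      have hx0 : x ≠ 0 := by
        rintro rfl
        simp at hx
      rcases lt_or_ge (value P x) 0 with hneg | hpos
      · have h : ∀ᶠ q : Quartic × (Fin 4 → ℝ) in 𝓝 (P, x), value q.1 q.2 < 0 :=
          continuous_value.continuousAt.eventually_lt continuousAt_const hneg
        rw [nhds_prod_eq, eventually_prod_iff] at h
        obtain ⟨p₁, hp₁, p₂, hp₂, h⟩ := h
        exact ⟨{y | p₂ y}, mem_nhdsWithin_of_mem_nhds hp₂, ∅, Set.empty_subset _, Set.finite_empty,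
          hp₁.mono fun P' h' y hy hpos => absurd hpos (lt_asymm (h h' hy))⟩
      · obtain ⟨z, hzP, hz⟩ := exists_joinedIn_nearby hP hx0 hpos
        rw [nhds_prod_eq, eventually_prod_iff] at hz
        obtain ⟨p₁, hp₁, p₂, hp₂, hz⟩ := hz
        exact ⟨{y | p₂ y}, mem_nhdsWithin_of_mem_nhds hp₂, {z}, Set.singleton_subset_iff.2 hzP,
          Set.finite_singleton z, hp₁.mono fun P' h y hy hpos => ⟨z, rfl, hz h hy hpos⟩⟩
  obtain ⟨Z, hZP, hZ, h⟩ := key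
  refine ⟨Z, hZP, hZ, h.mono fun P' h y hy => ?_⟩
  have hy0 := ne_zero_of_mem_posSet hy
  have hc : 0 < ‖y‖⁻¹ := by positivity
  obtain ⟨z, hz, hj⟩ := h _ (normalize_mem_sphere hy0) (smul_mem_posSet hy hc.ne')
  exact ⟨z, hz, (joinedIn_smul hy hc).trans hj⟩

/-- The image of the path is compact, so the same path stays positive for nearby forms. -/
theorem eventually_joinedIn {P : Quartic} {a b : Fin 4 → ℝ} (h : JoinedIn (posSet P) a b) :
    ∀ᶠ P' in 𝓝 P, JoinedIn (posSet P') a b := by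
  obtain ⟨γ, hγ⟩ := h
  have hK : IsCompact (Set.range γ) := isCompact_range γ.continuous
  have := hK.eventually_forall_of_forall_eventually (x₀ := P) (P := fun P' y => 0 < value P' y) (by
    rintro _ ⟨t, rfl⟩
    exact continuousAt_const.eventually_lt continuous_value.continuousAt (hγ t))
  filter_upwards [this] with P' h
  exact ⟨γ, fun t => h _ ⟨t, rfl⟩⟩

/-- Split the positive cone of `P` into the component `J` of `a` and the rest `J'`. On the sphere
their closures are disjoint compact sets, and every point outside disjoint open neighbourhoods of
them satisfies `P < 0`. Nearby forms are negative there too, so a path positive for such a form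
cannot cross from one side to the other. -/
theorem eventually_not_joinedIn {P : Quartic} (hP : RealRegular P) {a b : Fin 4 → ℝ}
    (ha : a ∈ posSet P) (hb : b ∈ posSet P) (h : ¬ JoinedIn (posSet P) a b) :
    ∀ᶠ P' in 𝓝 P, ¬ JoinedIn (posSet P') a b := by
  set S := Metric.sphere (0 : Fin 4 → ℝ) 1 with hS
  set J := {y | JoinedIn (posSet P) a y}
  set J' := {y | y ∈ posSet P ∧ ¬ JoinedIn (posSet P) a y}
  have hSc : IsCompact S := isCompact_sphere _ _
  have hne : ∀ x ∈ S, x ≠ 0 := by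
    rintro x hx rfl
    simp [hS] at hx
  -- At a common limit point `P ≥ 0`, so by `exists_joinedIn_nearby` nearby points of `J` and of
  -- `J'` are joined to the same `z`, a contradiction.
  have hdisj : Disjoint (S ∩ closure J) (S ∩ closure J') := by
    rw [Set.disjoint_left]
    rintro x ⟨hxS, hx⟩ ⟨-, hx'⟩
    have hpos : 0 ≤ value P x := by
      have hcl : IsClosed {y | 0 ≤ value P y} :=
        isClosed_le continuous_const (continuous_value.comp (Continuous.prodMk_right P))
      exact closure_minimal (t := {y | 0 ≤ value P y})
        (fun y (hy : y ∈ J') => show 0 ≤ value P y from le_of_lt hy.1) hcl hx'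
    obtain ⟨z, -, hz⟩ := exists_joinedIn_nearby hP (hne x hxS) hpos
    have hz' : ∀ᶠ y in 𝓝 x, y ∈ posSet P → JoinedIn (posSet P) y z :=
      (Continuous.prodMk_right P).tendsto x |>.eventually hz
    obtain ⟨y, hyJ, hy⟩ := ((mem_closure_iff_frequently.1 hx).and_eventually hz').exists
    obtain ⟨y', hyJ', hy'⟩ := ((mem_closure_iff_frequently.1 hx').and_eventually hz').exists
    exact hyJ'.2 (hyJ.trans ((hy hyJ.target_mem).trans (hy' hyJ'.1).symm))
  obtain ⟨U, V, hU, hV, hJU, hJV, hUV⟩ :=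
    SeparatedNhds.of_isCompact_isCompact (hSc.inter_right isClosed_closure)
      (hSc.inter_right isClosed_closure) hdisj
  -- Regularity enters here: every zero is a limit of positive points, so it lies in one of the two
  -- closures.
  have hcover : ∀ x ∈ S \ (U ∪ V), value P x < 0 := by
    rintro x ⟨hxS, hx⟩
    by_contra! hpos
    have hcl := mem_closure_posSet hP (hne x hxS) hpos
    have hsub : posSet P ⊆ J ∪ J' := fun y hy => by
      by_cases hj : JoinedIn (posSet P) a y
      · exact Or.inl hj
      · exact Or.inr ⟨hy, hj⟩
    have := closure_mono hsub hcl
    rw [closure_union] at this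
    rcases this with h | h
    · exact hx (Or.inl (hJU ⟨hxS, h⟩))
    · exact hx (Or.inr (hJV ⟨hxS, h⟩))
  have hev := (hSc.diff (hU.union hV)).eventually_forall_of_forall_eventually (x₀ := P)
    (P := fun P' y => value P' y < 0) fun y hy =>
      continuous_value.continuousAt.eventually_lt continuousAt_const (hcover y hy)
  filter_upwards [hev] with P' hP' hj
  obtain ⟨γ, hγ⟩ := hj
  have hγ0 : ∀ t, γ t ≠ 0 := fun t => ne_zero_of_mem_posSet (hγ t)
  have hcont : Continuous fun t => ‖γ t‖⁻¹ • γ t :=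
    (γ.continuous.norm.inv₀ fun t => norm_ne_zero_iff.2 (hγ0 t)).smul γ.continuous
  have hconn : IsPreconnected (Set.range fun t => ‖γ t‖⁻¹ • γ t) := isPreconnected_range hcont
  have hsub : (Set.range fun t => ‖γ t‖⁻¹ • γ t) ⊆ U ∪ V := by
    rintro _ ⟨t, rfl⟩
    by_contra hn
    have h1 := hP' _ ⟨normalize_mem_sphere (hγ0 t), hn⟩
    have h2 := smul_mem_posSet (hγ t) (inv_ne_zero (norm_ne_zero_iff.2 (hγ0 t)))
    exact lt_asymm h1 h2
  have ha0 := ne_zero_of_mem_posSet ha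
  have hb0 := ne_zero_of_mem_posSet hb
  have hca : 0 < ‖a‖⁻¹ := by positivity
  have hcb : 0 < ‖b‖⁻¹ := by positivity
  have haU : ‖a‖⁻¹ • a ∈ U :=
    hJU ⟨normalize_mem_sphere ha0, subset_closure (joinedIn_smul ha hca)⟩
  have hbV : ‖b‖⁻¹ • b ∈ V :=
    hJV ⟨normalize_mem_sphere hb0, subset_closure ⟨smul_mem_posSet hb hcb.ne', fun h' =>
      h (h'.trans (joinedIn_smul hb hcb).symm)⟩⟩
  obtain ⟨w, -, hw⟩ := hconn U V hU hV hsub ⟨_, ⟨0, by simp⟩, haU⟩ ⟨_, ⟨1, by simp⟩, hbV⟩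
  exact Set.disjoint_left.1 hUV hw.1 hw.2

/-! ### The two invariants and their local constancy -/

/-- Some antipodal pair of vectors is joined by a path along which `P` is positive. -/
def HasAntipodalPath (P : Quartic) : Prop := ∃ x, JoinedIn (posSet P) x (-x)

/-- Any two vectors at which `P` is positive are joined by a path along which `P` is positive. -/
def PosConnected (P : Quartic) : Prop :=
  ∀ x ∈ posSet P, ∀ y ∈ posSet P, JoinedIn (posSet P) x y

theorem joinedIn_neg {P : Quartic} {a b : Fin 4 → ℝ} (h : JoinedIn (posSet P) a b) :
    JoinedIn (posSet P) (-a) (-b) := by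
  obtain ⟨γ, hγ⟩ := h
  refine ⟨γ.map continuous_neg, fun t => ?_⟩
  have := hγ t
  simpa [posSet, value_neg] using this

/-- An antipodal path persists. Conversely, if `x` is joined to a base point `z`, then `-x` is
joined to `-z` by evenness, so an antipodal path of a nearby form yields one from `z` to `-z`; only
finitely many `z` have to be excluded. -/
theorem eventually_hasAntipodalPath_iff {P : Quartic} (hP : RealRegular P) :
    ∀ᶠ P' in 𝓝 P, (HasAntipodalPath P ↔ HasAntipodalPath P') := by
  by_cases h : HasAntipodalPath P
  · obtain ⟨x, hx⟩ := h
    filter_upwards [eventually_joinedIn hx] with P' h'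
    exact ⟨fun _ => ⟨x, h'⟩, fun _ => ⟨x, hx⟩⟩
  · obtain ⟨Z, hZP, hZ, hcover⟩ := exists_finite_joinedIn hP
    have h1 : ∀ᶠ P' in 𝓝 P, ∀ z ∈ Z, ¬ JoinedIn (posSet P') z (-z) := by
      rw [eventually_all_finite hZ]
      intro z hz
      have hz' : -z ∈ posSet P := by
        have := hZP hz
        rwa [posSet, Set.mem_ofPred_eq, value_neg]
      exact eventually_not_joinedIn hP (hZP hz) hz' fun hj => h ⟨z, hj⟩
    filter_upwards [h1, hcover] with P' h1 h2
    refine iff_of_false h ?_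
    rintro ⟨x, hx⟩
    obtain ⟨z, hz, hj⟩ := h2 x hx.source_mem
    exact h1 z hz (hj.symm.trans (hx.trans (joinedIn_neg hj)))

/-- If all positive points are joined, it suffices to keep the finitely many base points joined to
each other; if some pair is not joined, that pair stays positive and not joined. -/
theorem eventually_posConnected_iff {P : Quartic} (hP : RealRegular P) :
    ∀ᶠ P' in 𝓝 P, (PosConnected P ↔ PosConnected P') := by
  by_cases h : PosConnected P
  · obtain ⟨Z, hZP, hZ, hcover⟩ := exists_finite_joinedIn hP
    have h1 : ∀ᶠ P' in 𝓝 P, ∀ z ∈ Z, ∀ w ∈ Z, JoinedIn (posSet P') z w := by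
      rw [eventually_all_finite hZ]
      intro z hz
      rw [eventually_all_finite hZ]
      intro w hw
      exact eventually_joinedIn (h z (hZP hz) w (hZP hw))
    filter_upwards [h1, hcover] with P' h1 h2
    refine iff_of_true h fun x hx y hy => ?_
    obtain ⟨z, hz, hxz⟩ := h2 x hx
    obtain ⟨w, hw, hyw⟩ := h2 y hy
    exact hxz.trans ((h1 z hz w hw).trans hyw.symm)
  · have h' := h
    unfold PosConnected at h'
    push Not at h'
    obtain ⟨x, hx, y, hy, hxy⟩ := h'
    have hpos : ∀ w ∈ posSet P, ∀ᶠ P' in 𝓝 P, w ∈ posSet P' := fun w hw =>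
      (eventually_joinedIn (JoinedIn.refl hw)).mono fun _ h => h.source_mem
    filter_upwards [eventually_not_joinedIn hP hx hy hxy, hpos x hx, hpos y hy] with P' hn hx' hy'
    exact iff_of_false h fun hc => hn (hc x hx' y hy')

/-! ### Separating and counting connected components -/

/-- A property that is locally constant on a set has the same value at two points of the set which
have the same connected component. -/
theorem iff_of_connectedComponentIn_eq {X : Type*} [TopologicalSpace X] {F : Set X} {p : X → Prop}
    (hp : ∀ x ∈ F, ∀ᶠ y in 𝓝 x, (p x ↔ p y)) {a b : X} (hb : b ∈ F) (ha : a ∈ F)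
    (h : connectedComponentIn F a = connectedComponentIn F b) : p a ↔ p b := by
  have hb' : b ∈ connectedComponentIn F a := h ▸ mem_connectedComponentIn hb
  exact (isPreconnected_connectedComponentIn (F := F) (x := a)).induction₂ (fun x y => p x ↔ p y)
    (fun x hx => mem_nhdsWithin_of_mem_nhds (hp x (connectedComponentIn_subset F a hx)))
    (fun _ _ _ _ _ _ h₁ h₂ => h₁.trans h₂) (fun _ _ _ _ h => h.symm)
    (mem_connectedComponentIn ha) hb'

theorem connectedComponents_mk_ne {X : Type*} [TopologicalSpace X] {F : Set X} {a b : X}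
    (ha : a ∈ F) (hb : b ∈ F) (h : connectedComponentIn F a ≠ connectedComponentIn F b) :
    ConnectedComponents.mk (⟨a, ha⟩ : F) ≠ ConnectedComponents.mk ⟨b, hb⟩ := by
  intro heq
  rw [ConnectedComponents.coe_eq_coe] at heq
  exact h (by rw [connectedComponentIn_eq_image ha, connectedComponentIn_eq_image hb, heq])

theorem three_le_card_connectedComponents {X : Type*} [TopologicalSpace X] {F : Set X} {a b c : X}
    (ha : a ∈ F) (hb : b ∈ F) (hc : c ∈ F)
    (hab : connectedComponentIn F a ≠ connectedComponentIn F b)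
    (hac : connectedComponentIn F a ≠ connectedComponentIn F c)
    (hbc : connectedComponentIn F b ≠ connectedComponentIn F c) :
    3 ≤ ENat.card (ConnectedComponents F) := by
  have h := Set.encard_le_encard (Set.subset_univ ({ConnectedComponents.mk (⟨a, ha⟩ : F),
    ConnectedComponents.mk ⟨b, hb⟩, ConnectedComponents.mk ⟨c, hc⟩} : Set (ConnectedComponents F)))
  rw [Set.encard_univ, Set.encard_eq_three.2 ⟨_, _, _, connectedComponents_mk_ne ha hb hab,
    connectedComponents_mk_ne ha hc hac, connectedComponents_mk_ne hb hc hbc, rfl⟩] at h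
  exact h

/-! ### Contractibility in RP3: lifting maps to nonzero vectors -/

theorem continuous_mk {X : Type*} [TopologicalSpace X] {f : X → Fin 4 → ℝ} (hf : Continuous f)
    (h0 : ∀ x, f x ≠ 0) : Continuous fun x => (Projectivization.mk ℝ (f x) (h0 x) : RP3) :=
  continuous_quotient_mk'.comp (hf.subtype_mk h0)

theorem dotProduct_self_pos {x : Fin 4 → ℝ} (hx : x ≠ 0) : 0 < x ⬝ᵥ x :=
  lt_of_le_of_ne (Finset.sum_nonneg fun _ _ => mul_self_nonneg _)
    fun h => hx (dotProduct_self_eq_zero.1 h.symm)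

/-- The orthogonal projection of a vector `w` to the line `p`. -/
noncomputable def lineProj (p : RP3) (w : Fin 4 → ℝ) : Fin 4 → ℝ :=
  Projectivization.lift (fun x : {x : Fin 4 → ℝ // x ≠ 0} => ((x.1 ⬝ᵥ w) / (x.1 ⬝ᵥ x.1)) • x.1) (by
    rintro ⟨a, ha⟩ ⟨b, hb⟩ t (rfl : a = t • b)
    have ht : t ≠ 0 := fun h => ha (by simp [h])
    have hb' := (dotProduct_self_pos hb).ne'
    simp only [smul_dotProduct, dotProduct_smul, smul_smul, smul_eq_mul]
    congr 1
    field_simp) p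

theorem lineProj_mk {x : Fin 4 → ℝ} (hx : x ≠ 0) (w : Fin 4 → ℝ) :
    lineProj (Projectivization.mk ℝ x hx) w = ((x ⬝ᵥ w) / (x ⬝ᵥ x)) • x := rfl

theorem continuous_lineProj_left (w : Fin 4 → ℝ) : Continuous fun p : RP3 => lineProj p w := by
  refine Continuous.quotient_lift (s := projectivizationSetoid ℝ (Fin 4 → ℝ)) ?_ _
  have h1 (u : Fin 4 → ℝ) : Continuous fun x : {x : Fin 4 → ℝ // x ≠ 0} => x.1 ⬝ᵥ u :=
    continuous_subtype_val.dotProduct continuous_const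
  have h2 : Continuous fun x : {x : Fin 4 → ℝ // x ≠ 0} => x.1 ⬝ᵥ x.1 :=
    continuous_subtype_val.dotProduct continuous_subtype_val
  exact ((h1 w).div h2 fun x => (dotProduct_self_pos x.2).ne').smul continuous_subtype_val

/-- Linearity in `w` reduces joint continuity to continuity in the line for the four basis vectors.
-/
theorem lineProj_eq_sum (p : RP3) (w : Fin 4 → ℝ) :
    lineProj p w = ∑ i, w i • lineProj p (Pi.single i 1) := by
  induction p using Projectivization.ind with
  | h x hx =>
    simp only [lineProj_mk, smul_smul, ← Finset.sum_smul, dotProduct_single_one]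
    congr 1
    rw [dotProduct, Finset.sum_div]
    exact Finset.sum_congr rfl fun i _ => by ring

theorem continuous_lineProj : Continuous fun q : RP3 × (Fin 4 → ℝ) => lineProj q.1 q.2 := by
  simp only [fun q : RP3 × (Fin 4 → ℝ) => lineProj_eq_sum q.1 q.2]
  exact continuous_finsetSum _ fun i _ => ((continuous_apply i).comp continuous_snd).smul
    ((continuous_lineProj_left _).comp continuous_fst)

/-- `σ` is a continuous choice of nonzero vectors on the lines `f x`. -/
def IsVectorLift {X : Type*} [TopologicalSpace X] (f : X → RP3) (σ : X → Fin 4 → ℝ) : Prop :=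
  Continuous σ ∧ ∀ x, ∃ h : σ x ≠ 0, Projectivization.mk ℝ (σ x) h = f x

theorem mk_lineProj {p : RP3} {w : Fin 4 → ℝ} (h : lineProj p w ≠ 0) :
    Projectivization.mk ℝ (lineProj p w) h = p := by
  induction p using Projectivization.ind with
  | h x hx =>
    rw [Projectivization.mk_eq_mk_iff']
    exact ⟨_, (lineProj_mk hx w).symm⟩

/-- The squared cosine of the angle between two lines. -/
noncomputable def lineCos (p q : RP3) : ℝ :=
  ∑ i, lineProj p (lineProj q (Pi.single i 1)) i

/-- `lineCos` is the trace of the composite of two rank-one projections, a form that makes its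
continuity on RP3 evident; this formula gives its geometric meaning. -/
theorem lineCos_mk {x y : Fin 4 → ℝ} (hx : x ≠ 0) (hy : y ≠ 0) :
    lineCos (Projectivization.mk ℝ x hx) (Projectivization.mk ℝ y hy) =
      (x ⬝ᵥ y) ^ 2 / ((x ⬝ᵥ x) * (y ⬝ᵥ y)) := by
  have hx' := (dotProduct_self_pos hx).ne'
  have hy' := (dotProduct_self_pos hy).ne'
  simp only [lineCos, lineProj_mk, dotProduct_single_one, dotProduct_smul, Pi.smul_apply,
    smul_eq_mul]
  calc _ = ∑ i, ((x ⬝ᵥ y) / ((x ⬝ᵥ x) * (y ⬝ᵥ y))) * (x i * y i) :=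
        Finset.sum_congr rfl fun i _ => by field_simp
    _ = _ := by
      rw [← Finset.mul_sum]
      change _ * (x ⬝ᵥ y) = _
      ring

theorem lineCos_self (p : RP3) : lineCos p p = 1 := by
  induction p using Projectivization.ind with
  | h x hx =>
    have hx' := (dotProduct_self_pos hx).ne'
    rw [lineCos_mk]
    field_simp

theorem lineCos_comm (p q : RP3) : lineCos p q = lineCos q p := by
  induction p using Projectivization.ind with
  | h x hx =>
    induction q using Projectivization.ind with
    | h y hy => rw [lineCos_mk, lineCos_mk, dotProduct_comm x y, mul_comm (x ⬝ᵥ x)]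

theorem continuous_lineCos_comp {X : Type*} [TopologicalSpace X] {f g : X → RP3}
    (hf : Continuous f) (hg : Continuous g) : Continuous fun x => lineCos (f x) (g x) := by
  refine continuous_finsetSum _ fun i _ => (continuous_apply i).comp ?_
  exact continuous_lineProj.comp (hf.prodMk ((continuous_lineProj_left _).comp hg))

/-- Orthogonal projection of a chosen vector to a line that is not perpendicular to it is nonzero,
so a lift can be carried to any map that is pointwise not perpendicular to `f`. -/
theorem IsVectorLift.transfer {X : Type*} [TopologicalSpace X] {f g : X → RP3}
    {σ : X → Fin 4 → ℝ} (hσ : IsVectorLift f σ) (hg : Continuous g)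
    (h : ∀ x, 0 < lineCos (f x) (g x)) : IsVectorLift g fun x => lineProj (g x) (σ x) := by
  refine ⟨continuous_lineProj.comp (hg.prodMk hσ.1), fun x => ?_⟩
  have hne : lineProj (g x) (σ x) ≠ 0 := by
    obtain ⟨h0, hx⟩ := hσ.2 x
    have h' := h x
    rw [← hx] at h'
    induction hgx : g x using Projectivization.ind with
    | h y hy =>
      rw [hgx, lineCos_mk] at h'
      rw [lineProj_mk, smul_ne_zero_iff]
      refine ⟨div_ne_zero (fun h0 => ?_) (dotProduct_self_pos hy).ne', hy⟩
      rw [dotProduct_comm, h0] at h'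
      norm_num at h'
  exact ⟨hne, mk_lineProj hne⟩

/-- A null-homotopic map from a compact space to `RP3` lifts to `ℝ⁴ \ {0}`. -/
theorem exists_isVectorLift_of_nullhomotopic {X : Type*} [TopologicalSpace X] [CompactSpace X]
    (f : C(X, RP3)) (hf : f.Nullhomotopic) : ∃ σ, IsVectorLift f σ := by
  obtain ⟨y, ⟨H⟩⟩ := hf
  -- Liftability of the slice `H(s, ·)` is locally constant in `s`: by compactness of `X`, slices at
  -- close times are nowhere perpendicular, so lifts transfer in both directions. The unit interval
  -- is connected and the constant slice lifts.
  have key := isPreconnected_univ (α := unitInterval).induction₂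
    (fun s s' => (∃ σ, IsVectorLift (fun x => H (s, x)) σ) ↔
      ∃ σ, IsVectorLift (fun x => H (s', x)) σ)
    (fun s _ => by
      rw [nhdsWithin_univ]
      have hc : Continuous fun q : unitInterval × X => lineCos (H (s, q.2)) (H q) :=
        continuous_lineCos_comp (H.continuous.comp (continuous_const.prodMk continuous_snd))
          H.continuous
      have := (isCompact_univ (X := X)).eventually_forall_of_forall_eventually (x₀ := s)
        (P := fun s' x => 0 < lineCos (H (s, x)) (H (s', x))) fun x _ =>
          (hc.tendsto (s, x)).eventually_const_lt (by rw [lineCos_self]; exact one_pos)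
      filter_upwards [this] with s' hs'
      constructor
      · rintro ⟨σ, hσ⟩
        exact ⟨_, hσ.transfer (H.continuous.comp (continuous_const.prodMk continuous_id)) fun x => hs' x (Set.mem_univ x)⟩
      · rintro ⟨σ, hσ⟩
        refine ⟨_, hσ.transfer (H.continuous.comp (continuous_const.prodMk continuous_id)) fun x => ?_⟩
        rw [lineCos_comm]
        exact hs' x (Set.mem_univ x))
    (fun _ _ _ _ _ _ h₁ h₂ => h₁.trans h₂) (fun _ _ _ _ h => h.symm)
    (Set.mem_univ 1) (Set.mem_univ 0)
  simp only [ContinuousMap.Homotopy.apply_one, ContinuousMap.Homotopy.apply_zero,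
    ContinuousMap.const_apply] at key
  refine key.1 ⟨fun _ => y.rep, continuous_const, fun _ => ⟨y.rep_nonzero, y.mk_rep⟩⟩

/-- A compact subset of `RP3` that contains a loop which lifts to a path between antipodal vectors
is not contractible in `RP3`. -/
theorem not_contractibleIn_of_antipodal_path {L : Set RP3} (hL : IsCompact L)
    {γ : ℝ → Fin 4 → ℝ} (hγ : Continuous γ) (hγ0 : ∀ t, γ t ≠ 0)
    (hγL : ∀ t, Projectivization.mk ℝ (γ t) (hγ0 t) ∈ L) (hanti : γ 1 = -γ 0) :
    ¬ ContractibleIn L := by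
  intro hcon
  have : CompactSpace L := isCompact_iff_compactSpace.1 hL
  obtain ⟨σ, hσ, hσL⟩ := exists_isVectorLift_of_nullhomotopic _ hcon
  set δ : ℝ → L := fun t => ⟨_, hγL t⟩
  have hδ : Continuous δ := (continuous_mk hγ hγ0).subtype_mk _
  have hδ01 : δ 1 = δ 0 := by
    refine Subtype.ext ((Projectivization.mk_eq_mk_iff' _ _ _ _ _).2 ⟨-1, ?_⟩)
    rw [hanti, neg_one_smul]
  -- The lift `σ` takes equal values at the two ends of the loop, while `γ` changes sign; yet `σ`
  -- and `γ` are parallel and nonzero, so `c` would change sign without vanishing.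
  set c : ℝ → ℝ := fun t => σ (δ t) ⬝ᵥ γ t
  have hc : Continuous c := (hσ.comp hδ).dotProduct hγ
  have hc0 : ∀ t, c t ≠ 0 := by
    intro t
    obtain ⟨h0, h1⟩ := hσL (δ t)
    obtain ⟨a, ha⟩ := (Projectivization.mk_eq_mk_iff' ℝ _ _ h0 (hγ0 t)).1 h1
    have ha0 : a ≠ 0 := fun h => h0 (by rw [← ha, h, zero_smul])
    simp only [c, ← ha, smul_dotProduct, smul_eq_mul]
    exact mul_ne_zero ha0 (dotProduct_self_pos (hγ0 t)).ne'
  have hc1 : c 1 = -c 0 := by simp only [c, hδ01, hanti, dotProduct_neg]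
  have h0 : (0 : ℝ) ∈ Set.uIcc (c 0) (c 1) := by
    rw [hc1, Set.mem_uIcc]
    rcases le_total (c 0) 0 with h | h
    · exact Or.inl ⟨h, by linarith⟩
    · exact Or.inr ⟨by linarith, h⟩
  obtain ⟨t, -, ht⟩ := intermediate_value_uIcc hc.continuousOn h0
  exact hc0 t ht

/-- A subset of the affine chart `X₀ ≠ 0` is contractible in `RP3`. -/
theorem contractibleIn_of_affine {L : Set RP3}
    (hL : ∀ (x : Fin 4 → ℝ) (hx : x ≠ 0), Projectivization.mk ℝ x hx ∈ L → x 0 ≠ 0) :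
    ContractibleIn L := by
  set e : Fin 4 → ℝ := Pi.single 0 1
  have hpos : ∀ p ∈ L, 0 < lineProj p e 0 := by
    intro p hp
    induction p using Projectivization.ind with
    | h x hx =>
      have h0 := hL x hx hp
      have := dotProduct_self_pos hx
      simp only [lineProj_mk, e, dotProduct_single_one, Pi.smul_apply, smul_eq_mul]
      rw [div_mul_eq_mul_div]
      exact div_pos (mul_self_pos.2 h0) this
  -- Both ends have positive coordinate `X₀`, so the segment avoids the origin.
  set v : unitInterval × L → Fin 4 → ℝ := fun q =>
    (1 - (q.1 : ℝ)) • lineProj q.2 e + (q.1 : ℝ) • e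
  have hv : Continuous v := by
    have h1 : Continuous fun q : unitInterval × L => lineProj q.2 e :=
      (continuous_lineProj_left e).comp (continuous_subtype_val.comp continuous_snd)
    fun_prop
  have hv0 : ∀ q, v q ≠ 0 := by
    intro q hq
    have h1 := congrFun hq 0
    simp only [v, e, Pi.add_apply, Pi.smul_apply, smul_eq_mul, Pi.single_eq_same, mul_one,
      Pi.zero_apply] at h1
    have h2 := hpos q.2 q.2.2
    simp only [e] at h2
    have h3 : 0 ≤ (q.1 : ℝ) := q.1.2.1
    have h4 : (q.1 : ℝ) ≤ 1 := q.1.2.2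
    rcases h3.eq_or_lt with h5 | h5
    · rw [← h5] at h1
      linarith
    · have := mul_nonneg (sub_nonneg.2 h4) h2.le
      linarith
  have he : e ≠ 0 := fun h => by simpa [e] using congrFun h 0
  refine ⟨Projectivization.mk ℝ e he, ⟨⟨⟨fun q => Projectivization.mk ℝ (v q) (hv0 q),
    continuous_mk hv hv0⟩, fun p => ?_, fun p => ?_⟩⟩⟩
  · have h0 : lineProj p.1 e ≠ 0 := fun h => (hpos p p.2).ne' (by rw [h]; rfl)
    calc Projectivization.mk ℝ (v (0, p)) (hv0 _) = Projectivization.mk ℝ (lineProj p.1 e) h0 := by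
          congr 1; simp [v]
      _ = p := mk_lineProj h0
  · change Projectivization.mk ℝ (v (1, p)) (hv0 _) = _
    congr 1
    simp [v]

/-! ### Real loci, polar coordinates and a criterion for tori -/

theorem mk_mem_realLocus {P : Quartic} {x : Fin 4 → ℝ} (hx : x ≠ 0) :
    Projectivization.mk ℝ x hx ∈ realLocus P ↔ value P x = 0 := by
  have hz : complexify x ≠ 0 := fun h => hx (complexify_injective (by simpa using h))
  have key : aeval (complexify x) (P : MvPolynomial (Fin 4) ℝ) = 0 ↔ value P x = 0 := by
    rw [aeval_complexify]
    exact Complex.ofReal_eq_zero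
  rw [← key]
  constructor
  · rintro ⟨z, hz0, hPz, h⟩
    rw [realPoints, Projectivization.map_mk, Projectivization.mk_eq_mk_iff'] at h
    obtain ⟨a, ha⟩ := h
    rw [← ha, aeval_smul_quartic, hPz, mul_zero]
  · exact fun h => ⟨_, hz, h, rfl⟩

theorem exists_polar (a b : ℝ) : ∃ r θ : ℝ, 0 ≤ r ∧ a = r * Real.cos θ ∧ b = r * Real.sin θ :=
  ⟨‖(⟨a, b⟩ : ℂ)‖, Complex.arg ⟨a, b⟩, norm_nonneg _, (Complex.norm_mul_cos_arg ⟨a, b⟩).symm,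
    (Complex.norm_mul_sin_arg ⟨a, b⟩).symm⟩

theorem exists_int_of_cos_sin_eq {a b : ℝ} (hc : Real.cos a = Real.cos b)
    (hs : Real.sin a = Real.sin b) : ∃ k : ℤ, a = b + 2 * Real.pi * k := by
  obtain ⟨k, hk⟩ := Real.Angle.angle_eq_iff_two_pi_dvd_sub.1 (Real.Angle.cos_sin_inj hc hs)
  exact ⟨k, by linarith⟩

/-- A linear relation among `F`, `∂₁F`, `∂₂F` says that the derivative along some `w` is parallel to
`F`. Once `w = 0`, the coefficient of `F` vanishes because `F x ≠ 0`, so only `w` has to be tested.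
-/
theorem isTorus_range {F : ℝ × ℝ → Fin 4 → ℝ} (hF : ∀ x, F x ≠ 0) (hs : ContDiff ℝ ∞ F)
    (himm : ∀ (x w : ℝ × ℝ) (c : ℝ) (F' : Fin 4 → ℝ),
      HasDerivAt (fun τ : ℝ => F (x + τ • w)) F' 0 → c • F x + F' = 0 → w = 0)
    (hinj : ∀ x y, Projectivization.mk ℝ (F x) (hF x) = Projectivization.mk ℝ (F y) (hF y) ↔
      ∃ m n : ℤ, y = x + ((m : ℝ), (n : ℝ))) :
    IsTorus (Set.range fun x => Projectivization.mk ℝ (F x) (hF x)) := by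
  refine ⟨F, hF, hs, fun x => ?_, hinj, rfl⟩
  rw [Fintype.linearIndependent_iff]
  intro g hg
  simp only [Fin.sum_univ_three, Matrix.cons_val] at hg
  have hd : HasDerivAt (fun τ : ℝ => F (x + τ • (g 1, g 2))) (fderiv ℝ F x (g 1, g 2)) 0 := by
    have h1 : HasDerivAt (fun τ : ℝ => x + τ • (g 1, g 2)) (g 1, g 2) 0 := by
      simpa using ((hasDerivAt_id (0 : ℝ)).smul_const (g 1, g 2)).const_add x
    have h2 : HasFDerivAt F (fderiv ℝ F x) (x + (0 : ℝ) • (g 1, g 2)) := by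
      rw [zero_smul, add_zero]
      exact (hs.differentiable (by simp) x).hasFDerivAt
    exact h2.comp_hasDerivAt 0 h1
  have hlin : fderiv ℝ F x (g 1, g 2) = g 1 • fderiv ℝ F x (1, 0) + g 2 • fderiv ℝ F x (0, 1) := by
    rw [← map_smul, ← map_smul, ← map_add]
    simp
  have hw := himm x (g 1, g 2) (g 0) _ hd (by rw [hlin, ← add_assoc]; exact hg)
  obtain ⟨h1, h2⟩ := Prod.mk_eq_zero.1 hw
  have h0 : g 0 = 0 := by
    rw [h1, h2, zero_smul, zero_smul, add_zero, add_zero] at hg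
    exact (smul_eq_zero.1 hg).resolve_right (hF x)
  intro i
  fin_cases i
  exacts [h0, h1, h2]

theorem IsTorus.isCompact {L : Set RP3} (hL : IsTorus L) : IsCompact L := by
  obtain ⟨F, hF, hs, -, hinj, rfl⟩ := hL
  have hc : Continuous fun x => (Projectivization.mk ℝ (F x) (hF x) : RP3) :=
    continuous_mk hs.continuous hF
  have himg : (Set.range fun x => (Projectivization.mk ℝ (F x) (hF x) : RP3)) =
      (fun x => Projectivization.mk ℝ (F x) (hF x)) '' (Set.Icc 0 1 ×ˢ Set.Icc 0 1) := by
    refine Set.Subset.antisymm ?_ (Set.image_subset_range _ _)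
    rintro _ ⟨x, rfl⟩
    refine ⟨(Int.fract x.1, Int.fract x.2), ⟨⟨Int.fract_nonneg _, (Int.fract_lt_one _).le⟩,
      ⟨Int.fract_nonneg _, (Int.fract_lt_one _).le⟩⟩, ?_⟩
    rw [hinj]
    exact ⟨⌊x.1⌋, ⌊x.2⌋, by ext <;> simp⟩
  rw [himg]
  exact (isCompact_Icc.prod isCompact_Icc).image hc

/-! ### Clifford tori -/

/-- The map `(s, t) ↦ (ρ cos θ, ρ sin θ, cos φ, sin φ)`, with `θ = π (s + t)`, `φ = π (s - t)` and
`ρ` a function of `θ` and `φ`. -/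
noncomputable def cliffordMap (ρ : ℝ × ℝ → ℝ) (x : ℝ × ℝ) : Fin 4 → ℝ :=
  ![ρ (Real.pi * (x.1 + x.2), Real.pi * (x.1 - x.2)) * Real.cos (Real.pi * (x.1 + x.2)),
    ρ (Real.pi * (x.1 + x.2), Real.pi * (x.1 - x.2)) * Real.sin (Real.pi * (x.1 + x.2)),
    Real.cos (Real.pi * (x.1 - x.2)), Real.sin (Real.pi * (x.1 - x.2))]

theorem cliffordMap_ne_zero (ρ : ℝ × ℝ → ℝ) (x : ℝ × ℝ) : cliffordMap ρ x ≠ 0 := by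
  intro h
  have h2 : Real.cos (Real.pi * (x.1 - x.2)) = 0 := congrFun h 2
  have h3 : Real.sin (Real.pi * (x.1 - x.2)) = 0 := congrFun h 3
  have := Real.sin_sq_add_cos_sq (Real.pi * (x.1 - x.2))
  rw [h2, h3] at this
  norm_num at this

/-- The torus in `RP3` parametrized by `cliffordMap`. -/
def cliffordTorus (ρ : ℝ × ℝ → ℝ) : Set RP3 :=
  Set.range fun x => Projectivization.mk ℝ (cliffordMap ρ x) (cliffordMap_ne_zero ρ x)

/-- Conditions on a radius function which ensure that `cliffordTorus` is a torus. -/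
structure IsRadius (ρ : ℝ × ℝ → ℝ) : Prop where
  contDiff : ContDiff ℝ ∞ ρ
  pos : ∀ x, 0 < ρ x
  periodic_fst : ∀ a b, ρ (a + Real.pi, b) = ρ (a, b)
  periodic_snd : ∀ a b, ρ (a, b + Real.pi) = ρ (a, b)

theorem exists_sign_of_smul_circle {a b c : ℝ}
    (hc : c * Real.cos b = Real.cos a) (hs : c * Real.sin b = Real.sin a) : c = 1 ∨ c = -1 := by
  have h1 := Real.sin_sq_add_cos_sq a
  have h2 := Real.sin_sq_add_cos_sq b
  rw [← hc, ← hs] at h1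
  have : c ^ 2 = 1 := by
    calc c ^ 2 = c ^ 2 * (Real.sin b ^ 2 + Real.cos b ^ 2) := by rw [h2, mul_one]
      _ = 1 := by rw [← h1]; ring
  exact eq_or_eq_neg_of_sq_eq_sq c 1 (by rw [this, one_pow])

theorem eq_of_polar_eq {a b r r' : ℝ} (hr : 0 < r) (hr' : 0 < r')
    (hc : r' * Real.cos b = r * Real.cos a) (hs : r' * Real.sin b = r * Real.sin a) :
    r' = r ∧ Real.cos b = Real.cos a ∧ Real.sin b = Real.sin a := by
  have h1 := Real.sin_sq_add_cos_sq a
  have h2 := Real.sin_sq_add_cos_sq b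
  have h : r' ^ 2 = r ^ 2 := by
    calc r' ^ 2 = (r' * Real.sin b) ^ 2 + (r' * Real.cos b) ^ 2 := by
          rw [mul_pow, mul_pow, ← mul_add, h2, mul_one]
      _ = r ^ 2 := by rw [hc, hs, mul_pow, mul_pow, ← mul_add, h1, mul_one]
  have h' : r' = r := by rwa [sq_eq_sq₀ hr'.le hr.le] at h
  subst h'
  exact ⟨rfl, mul_left_cancel₀ hr.ne' hc, mul_left_cancel₀ hr.ne' hs⟩

theorem IsRadius.add_int_mul_pi {ρ : ℝ × ℝ → ℝ} (hρ : IsRadius ρ) (a b : ℝ) (k l : ℤ) :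
    ρ (a + k * Real.pi, b + l * Real.pi) = ρ (a, b) := by
  have h1 : Function.Periodic (fun a' => ρ (a', b + l * Real.pi)) Real.pi :=
    fun a' => hρ.periodic_fst a' _
  have h2 : Function.Periodic (fun b' => ρ (a, b')) Real.pi := fun b' => hρ.periodic_snd a b'
  exact (h1.int_mul k a).trans (h2.int_mul l b)

/-- The shift adds `(m + n)π` to `θ` and `(m - n)π` to `φ`. These multiples of `π` have equal
parity, so both halves acquire the same sign: the parameters `s, t` are adapted to the lattice of
angle shifts that fix points of RP3. -/
theorem cliffordMap_add_int {ρ : ℝ × ℝ → ℝ} (hρ : IsRadius ρ) (x : ℝ × ℝ) (m n : ℤ) :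
    cliffordMap ρ (x + ((m : ℝ), (n : ℝ))) = ((-1 : ℝ) ^ (m + n)) • cliffordMap ρ x := by
  have h1 : Real.pi * ((x + ((m : ℝ), (n : ℝ))).1 + (x + ((m : ℝ), (n : ℝ))).2) =
      Real.pi * (x.1 + x.2) + (m + n : ℤ) * Real.pi := by
    push_cast [Prod.fst_add, Prod.snd_add]
    ring
  have h2 : Real.pi * ((x + ((m : ℝ), (n : ℝ))).1 - (x + ((m : ℝ), (n : ℝ))).2) =
      Real.pi * (x.1 - x.2) + (m - n : ℤ) * Real.pi := by
    push_cast [Prod.fst_add, Prod.snd_add]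
    ring
  have h3 : (-1 : ℝ) ^ (m - n) = (-1) ^ (m + n) := by
    rw [zpow_add₀ (by norm_num), zpow_sub₀ (by norm_num), div_eq_mul_inv, ← inv_zpow]
    norm_num
  unfold cliffordMap
  rw [h1, h2, hρ.add_int_mul_pi, Real.cos_add_int_mul_pi, Real.sin_add_int_mul_pi,
    Real.cos_add_int_mul_pi, Real.sin_add_int_mul_pi, h3]
  ext i
  fin_cases i <;> simp <;> ring

/-- The last two coordinates have norm one, so `c = ±1`. Allowing two radius functions gives
injectivity and disjointness of tori at once. -/
theorem cliffordMap_eq_smul {ρ ρ' : ℝ × ℝ → ℝ} (hρ : ∀ x, 0 < ρ x) (hρ' : ∀ x, 0 < ρ' x)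
    {x y : ℝ × ℝ} {c : ℝ} (h : c • cliffordMap ρ' y = cliffordMap ρ x) :
    ρ' (Real.pi * (y.1 + y.2), Real.pi * (y.1 - y.2)) =
      ρ (Real.pi * (x.1 + x.2), Real.pi * (x.1 - x.2)) ∧
      ∃ m n : ℤ, y = x + ((m : ℝ), (n : ℝ)) := by
  have e0 := congrFun h 0
  have e1 := congrFun h 1
  have e2 : c * Real.cos (Real.pi * (y.1 - y.2)) = Real.cos (Real.pi * (x.1 - x.2)) :=
    congrFun h 2
  have e3 : c * Real.sin (Real.pi * (y.1 - y.2)) = Real.sin (Real.pi * (x.1 - x.2)) :=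
    congrFun h 3
  simp only [cliffordMap, Pi.smul_apply, smul_eq_mul, Matrix.cons_val] at e0 e1
  have hpi := Real.pi_pos
  rcases exists_sign_of_smul_circle e2 e3 with rfl | rfl
  · rw [one_mul] at e0 e1 e2 e3
    obtain ⟨hr, hc, hs⟩ := eq_of_polar_eq (hρ _) (hρ' _) e0 e1
    obtain ⟨k, hk⟩ := exists_int_of_cos_sin_eq hc hs
    obtain ⟨l, hl⟩ := exists_int_of_cos_sin_eq e2 e3
    refine ⟨hr, k + l, k - l, ?_⟩
    have hk' : y.1 + y.2 = x.1 + x.2 + 2 * k := by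
      apply mul_left_cancel₀ hpi.ne'; rw [hk]; ring
    have hl' : y.1 - y.2 = x.1 - x.2 + 2 * l := by
      apply mul_left_cancel₀ hpi.ne'; rw [hl]; ring
    ext
    · simp only [Prod.fst_add]; push_cast; linarith
    · simp only [Prod.snd_add]; push_cast; linarith
  -- For `c = -1` the sign is absorbed in a half turn of both angles; adding the two resulting
  -- equations gives the shift `k + l - 1` of the first parameter.
  · obtain ⟨hr, hc, hs⟩ := eq_of_polar_eq (a := Real.pi * (x.1 + x.2))
      (b := Real.pi * (y.1 + y.2) + Real.pi) (hρ _) (hρ' _)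
      (by rw [Real.cos_add_pi, ← e0]; ring) (by rw [Real.sin_add_pi, ← e1]; ring)
    obtain ⟨k, hk⟩ := exists_int_of_cos_sin_eq hc hs
    obtain ⟨l, hl⟩ := exists_int_of_cos_sin_eq (a := Real.pi * (y.1 - y.2) + Real.pi)
      (b := Real.pi * (x.1 - x.2)) (by rw [← e2, Real.cos_add_pi]; ring)
      (by rw [← e3, Real.sin_add_pi]; ring)
    refine ⟨hr, k + l - 1, k - l, ?_⟩
    have hk' : y.1 + y.2 + 1 = x.1 + x.2 + 2 * k := by
      apply mul_left_cancel₀ hpi.ne'; linear_combination hk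
    have hl' : y.1 - y.2 + 1 = x.1 - x.2 + 2 * l := by
      apply mul_left_cancel₀ hpi.ne'; linear_combination hl
    ext
    · simp only [Prod.fst_add]; push_cast; linarith
    · simp only [Prod.snd_add]; push_cast; linarith

/-- The two expressions are the components of `(A, B)` rotated by `a`. In polar coordinates this
separates the radial and tangential parts of a derivative. -/
theorem eq_zero_of_rotation {a A B : ℝ} (h1 : A * Real.cos a - B * Real.sin a = 0)
    (h2 : A * Real.sin a + B * Real.cos a = 0) : A = 0 ∧ B = 0 := by
  have h := Real.sin_sq_add_cos_sq a
  constructor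
  · linear_combination Real.cos a * h1 + Real.sin a * h2 - A * h
  · linear_combination Real.cos a * h2 - Real.sin a * h1 - B * h

theorem isTorus_cliffordTorus {ρ : ℝ × ℝ → ℝ} (hρ : IsRadius ρ) : IsTorus (cliffordTorus ρ) := by
  have hpi := Real.pi_pos
  have hθ : ContDiff ℝ ∞ fun x : ℝ × ℝ => Real.pi * (x.1 + x.2) := by fun_prop
  have hφ : ContDiff ℝ ∞ fun x : ℝ × ℝ => Real.pi * (x.1 - x.2) := by fun_prop
  have hr : ContDiff ℝ ∞ fun x : ℝ × ℝ => ρ (Real.pi * (x.1 + x.2), Real.pi * (x.1 - x.2)) :=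
    hρ.contDiff.comp (hθ.prodMk hφ)
  refine isTorus_range (cliffordMap_ne_zero ρ) ?_ ?_ fun x y => ?_
  · rw [contDiff_pi]
    intro i
    fin_cases i
    · exact hr.mul (Real.contDiff_cos.comp hθ)
    · exact hr.mul (Real.contDiff_sin.comp hθ)
    · exact Real.contDiff_cos.comp hφ
    · exact Real.contDiff_sin.comp hφ
  · intro x w c F' hF' h
    have hline : HasDerivAt (fun τ : ℝ => x + τ • w) w 0 := by
      simpa using ((hasDerivAt_id (0 : ℝ)).smul_const w).const_add x
    have hfst : HasDerivAt (fun τ : ℝ => (x + τ • w).1) w.1 0 := by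
      simpa using ((hasDerivAt_id (0 : ℝ)).mul_const w.1).const_add x.1
    have hsnd : HasDerivAt (fun τ : ℝ => (x + τ • w).2) w.2 0 := by
      simpa using ((hasDerivAt_id (0 : ℝ)).mul_const w.2).const_add x.2
    have hdθ : HasDerivAt (fun τ : ℝ => Real.pi * ((x + τ • w).1 + (x + τ • w).2))
        (Real.pi * (w.1 + w.2)) 0 := (hfst.add hsnd).const_mul Real.pi
    have hdφ : HasDerivAt (fun τ : ℝ => Real.pi * ((x + τ • w).1 - (x + τ • w).2))
        (Real.pi * (w.1 - w.2)) 0 := (hfst.sub hsnd).const_mul Real.pi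
    obtain ⟨r', hdr⟩ : ∃ r', HasDerivAt (fun τ : ℝ => ρ (Real.pi * ((x + τ • w).1 + (x + τ • w).2),
        Real.pi * ((x + τ • w).1 - (x + τ • w).2))) r' 0 :=
      ⟨_, ((hr.differentiable (by simp) _).hasFDerivAt.comp_hasDerivAt 0 hline)⟩
    have hcomp := hasDerivAt_pi.1 hF'
    have d0 := (hcomp 0).unique (hdr.mul hdθ.cos)
    have d1 := (hcomp 1).unique (hdr.mul hdθ.sin)
    have d2 := (hcomp 2).unique hdφ.cos
    have d3 := (hcomp 3).unique hdφ.sin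
    have e0 := congrFun h 0
    have e1 := congrFun h 1
    have e2 := congrFun h 2
    have e3 := congrFun h 3
    simp only [Pi.add_apply, Pi.smul_apply, d0, d1, d2, d3, cliffordMap, Matrix.cons_val,
      smul_eq_mul, zero_smul, add_zero, Pi.zero_apply] at e0 e1 e2 e3
    -- The radial part `c ρ + r'` absorbs the unknown derivative of `ρ`; only the tangential part,
    -- which detects `w.1 + w.2`, is needed. The second circle detects `w.1 - w.2`.
    have hA := (eq_zero_of_rotation (a := Real.pi * (x.1 + x.2))
      (A := c * ρ (Real.pi * (x.1 + x.2), Real.pi * (x.1 - x.2)) + r')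
      (B := ρ (Real.pi * (x.1 + x.2), Real.pi * (x.1 - x.2)) * (Real.pi * (w.1 + w.2)))
      (by linear_combination e0) (by linear_combination e1)).2
    have hB := (eq_zero_of_rotation (a := Real.pi * (x.1 - x.2)) (A := c)
      (B := Real.pi * (w.1 - w.2)) (by linear_combination e2) (by linear_combination e3)).2
    have hA' := (mul_eq_zero.1 ((mul_eq_zero.1 hA).resolve_left (hρ.pos _).ne')).resolve_left hpi.ne'
    have hB' := (mul_eq_zero.1 hB).resolve_left hpi.ne'
    ext
    · simp only [Prod.fst_zero]; linarith
    · simp only [Prod.snd_zero]; linarith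
  · rw [Projectivization.mk_eq_mk_iff']
    constructor
    · rintro ⟨c, hc⟩
      exact (cliffordMap_eq_smul hρ.pos hρ.pos hc).2
    · rintro ⟨m, n, rfl⟩
      refine ⟨(-1) ^ (m + n), ?_⟩
      rw [cliffordMap_add_int hρ, smul_smul, ← mul_zpow]
      norm_num

theorem not_contractibleIn_cliffordTorus {ρ : ℝ × ℝ → ℝ} (hρ : IsRadius ρ) :
    ¬ ContractibleIn (cliffordTorus ρ) := by
  have hc : Continuous (cliffordMap ρ) := by
    have := hρ.contDiff.continuous
    rw [continuous_pi_iff]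
    intro i
    fin_cases i <;> simp only [cliffordMap] <;> fun_prop
  refine not_contractibleIn_of_antipodal_path (isTorus_cliffordTorus hρ).isCompact
    (γ := fun t => cliffordMap ρ (t, 0)) (by fun_prop) (fun t => cliffordMap_ne_zero ρ _)
    (fun t => ⟨(t, 0), rfl⟩) ?_
  have := cliffordMap_add_int hρ (0, 0) 1 0
  simpa using this

theorem disjoint_cliffordTorus {ρ ρ' : ℝ × ℝ → ℝ} (hρ : ∀ x, 0 < ρ x) (hρ' : ∀ x, 0 < ρ' x)
    (h : ∀ x y, ρ x ≠ ρ' y) : Disjoint (cliffordTorus ρ) (cliffordTorus ρ') := by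
  rw [Set.disjoint_left]
  rintro _ ⟨x, rfl⟩ ⟨y, hy⟩
  obtain ⟨c, hc⟩ := (Projectivization.mk_eq_mk_iff' ℝ _ _ _ _).1 hy.symm
  exact h _ _ (cliffordMap_eq_smul hρ hρ' hc).1.symm

/-- Membership in a `cliffordTorus`, for a vector given in double polar coordinates. -/
theorem mk_mem_cliffordTorus {ρ : ℝ × ℝ → ℝ} {A B θ φ : ℝ} (hA : A = ρ (θ, φ) * B)
    (h0 : ![A * Real.cos θ, A * Real.sin θ, B * Real.cos φ, B * Real.sin φ] ≠ 0) :
    Projectivization.mk ℝ _ h0 ∈ cliffordTorus ρ := by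
  have hpi := Real.pi_pos.ne'
  refine ⟨((θ + φ) / (2 * Real.pi), (θ - φ) / (2 * Real.pi)), ?_⟩
  have h1 : Real.pi * ((θ + φ) / (2 * Real.pi) + (θ - φ) / (2 * Real.pi)) = θ := by
    field_simp; ring
  have h2 : Real.pi * ((θ + φ) / (2 * Real.pi) - (θ - φ) / (2 * Real.pi)) = φ := by
    field_simp; ring
  refine ((Projectivization.mk_eq_mk_iff' ℝ _ _ _ _).2 ⟨B, ?_⟩).symm
  simp only [cliffordMap, h1, h2]
  ext i
  fin_cases i <;> simp [hA] <;> ring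

theorem exists_double_polar (x : Fin 4 → ℝ) : ∃ A B θ φ : ℝ, 0 ≤ A ∧ 0 ≤ B ∧
    x = ![A * Real.cos θ, A * Real.sin θ, B * Real.cos φ, B * Real.sin φ] := by
  obtain ⟨A, θ, hA, h0, h1⟩ := exists_polar (x 0) (x 1)
  obtain ⟨B, φ, hB, h2, h3⟩ := exists_polar (x 2) (x 3)
  refine ⟨A, B, θ, φ, hA, hB, ?_⟩
  ext i
  fin_cases i <;> assumption

/-- The real locus of `P` is a union of two Clifford tori if this is so in double polar
coordinates. -/
theorem realLocus_eq_cliffordTorus_union {P : Quartic} {ρ ρ' : ℝ × ℝ → ℝ}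
    (h : ∀ A B θ φ : ℝ, 0 ≤ A → 0 ≤ B →
      (value P ![A * Real.cos θ, A * Real.sin θ, B * Real.cos φ, B * Real.sin φ] = 0 ↔
        A = ρ (θ, φ) * B ∨ A = ρ' (θ, φ) * B)) (hρ : ∀ x, 0 < ρ x) (hρ' : ∀ x, 0 < ρ' x) :
    realLocus P = cliffordTorus ρ ∪ cliffordTorus ρ' := by
  ext p
  constructor
  · induction p using Projectivization.ind with
    | h x hx =>
      intro hp
      rw [mk_mem_realLocus] at hp
      obtain ⟨A, B, θ, φ, hA, hB, rfl⟩ := exists_double_polar x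
      rcases (h A B θ φ hA hB).1 hp with h | h
      · exact Or.inl (mk_mem_cliffordTorus h hx)
      · exact Or.inr (mk_mem_cliffordTorus h hx)
  · rintro (⟨x, rfl⟩ | ⟨x, rfl⟩)
    · refine (mk_mem_realLocus _).2 ?_
      have := (h _ 1 (Real.pi * (x.1 + x.2)) (Real.pi * (x.1 - x.2)) (hρ _).le zero_le_one).2
        (Or.inl (mul_one _).symm)
      simpa [cliffordMap] using this
    · refine (mk_mem_realLocus _).2 ?_
      have := (h _ 1 (Real.pi * (x.1 + x.2)) (Real.pi * (x.1 - x.2)) (hρ' _).le zero_le_one).2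
        (Or.inr (mul_one _).symm)
      simpa [cliffordMap] using this

/-! ### The oval `X² + Y⁴ = 1` -/

theorem cos_pow_add_sin_pow_pos (φ : ℝ) : 0 < Real.cos φ ^ 4 + 4 * Real.sin φ ^ 4 := by
  have h := Real.sin_sq_add_cos_sq φ
  have h2 : Real.cos φ ^ 2 = 1 - Real.sin φ ^ 2 := by linarith
  have : Real.cos φ ^ 4 + 4 * Real.sin φ ^ 4 =
      5 * (Real.sin φ ^ 2 - 1 / 5) ^ 2 + 4 / 5 := by
    rw [show Real.cos φ ^ 4 = (Real.cos φ ^ 2) ^ 2 by ring, h2]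
    ring
  rw [this]
  positivity

theorem ovalDenom_pos (φ : ℝ) :
    0 < Real.cos φ ^ 2 + √(Real.cos φ ^ 4 + 4 * Real.sin φ ^ 4) :=
  add_pos_of_nonneg_of_pos (sq_nonneg _) (Real.sqrt_pos.2 (cos_pow_add_sin_pow_pos φ))

/-- The polar radius of the oval `X² + Y⁴ = 1`. -/
noncomputable def ovalRadius (φ : ℝ) : ℝ :=
  √(2 / (Real.cos φ ^ 2 + √(Real.cos φ ^ 4 + 4 * Real.sin φ ^ 4)))

theorem ovalRadius_pos (φ : ℝ) : 0 < ovalRadius φ :=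
  Real.sqrt_pos.2 (div_pos two_pos (ovalDenom_pos φ))

/-- The squared radius is the positive root of `sin⁴ r⁴ + cos² r² = 1`, regarded as an equation in
`r²`. The rationalized form of the root has a positive denominator even where `sin φ = 0` and the
quadratic degenerates. -/
theorem contDiff_ovalRadius : ContDiff ℝ ∞ ovalRadius := by
  have h1 : ContDiff ℝ ∞ fun φ => √(Real.cos φ ^ 4 + 4 * Real.sin φ ^ 4) :=
    ContDiff.sqrt (by fun_prop) fun φ => (cos_pow_add_sin_pow_pos φ).ne'
  have h2 : ContDiff ℝ ∞ fun φ => Real.cos φ ^ 2 := by fun_prop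
  exact (contDiff_const.div (h2.add h1) fun φ => (ovalDenom_pos φ).ne').sqrt
    fun φ => (div_pos two_pos (ovalDenom_pos φ)).ne'

theorem ovalRadius_equation (φ : ℝ) :
    (ovalRadius φ * Real.cos φ) ^ 2 + (ovalRadius φ * Real.sin φ) ^ 4 = 1 := by
  have hD := ovalDenom_pos φ
  have hq := Real.sq_sqrt (cos_pow_add_sin_pow_pos φ).le
  have hR : ovalRadius φ ^ 2 = 2 / (Real.cos φ ^ 2 + √(Real.cos φ ^ 4 + 4 * Real.sin φ ^ 4)) :=
    Real.sq_sqrt (div_pos two_pos hD).le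
  set q := √(Real.cos φ ^ 4 + 4 * Real.sin φ ^ 4)
  calc (ovalRadius φ * Real.cos φ) ^ 2 + (ovalRadius φ * Real.sin φ) ^ 4
      = ovalRadius φ ^ 2 * Real.cos φ ^ 2 + (ovalRadius φ ^ 2) ^ 2 * Real.sin φ ^ 4 := by ring
    _ = 1 := by
      rw [hR]
      field_simp
      linear_combination -hq

/-- With `R` the oval radius, the difference of the two equations factors as `(r² - R²)(cos² + (r² +
R²) sin⁴)`, and the second factor is positive. -/
theorem eq_ovalRadius {r φ : ℝ} (hr : 0 ≤ r)
    (h : (r * Real.cos φ) ^ 2 + (r * Real.sin φ) ^ 4 = 1) : r = ovalRadius φ := by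
  have h1 := ovalRadius_equation φ
  have h2 : (r ^ 2 - ovalRadius φ ^ 2) *
      (Real.cos φ ^ 2 + (r ^ 2 + ovalRadius φ ^ 2) * Real.sin φ ^ 4) = 0 := by
    linear_combination h - h1
  have hR := ovalRadius_pos φ
  have h3 : 0 < Real.cos φ ^ 2 + (r ^ 2 + ovalRadius φ ^ 2) * Real.sin φ ^ 4 := by
    rcases eq_or_ne (Real.sin φ) 0 with h0 | h0
    · have h5 := Real.sin_sq_add_cos_sq φ
      rw [h0] at h5 ⊢
      linarith
    · positivity
  have h4 := (mul_eq_zero.1 h2).resolve_right h3.ne'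
  exact (sq_eq_sq₀ hr hR.le).1 (sub_eq_zero.1 h4)

/-! ### Tubes around a circle in an affine chart -/

/-- Conditions on the coefficients of `tubeMap` which ensure that it parametrizes a torus. -/
structure IsTube (m a b : ℝ → ℝ) : Prop where
  contDiff_center : ContDiff ℝ ∞ m
  contDiff_width : ContDiff ℝ ∞ a
  contDiff_height : ContDiff ℝ ∞ b
  periodic_center : Function.Periodic m (2 * Real.pi)
  periodic_width : Function.Periodic a (2 * Real.pi)
  periodic_height : Function.Periodic b (2 * Real.pi)
  width_pos : ∀ θ, 0 < a θ
  height_pos : ∀ θ, 0 < b θ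
  width_lt_center : ∀ θ, a θ < m θ

/-- The square of the distance from the axis of a point of the tube. -/
noncomputable def tubeSq (m a : ℝ → ℝ) (x : ℝ × ℝ) : ℝ :=
  m (2 * Real.pi * x.1) +
    a (2 * Real.pi * x.1) * (ovalRadius (2 * Real.pi * x.2) * Real.cos (2 * Real.pi * x.2))

/-- A parametrized tube around a circle in the affine chart `X₀ = 1`: at the angle `θ`, the square
of the distance from the axis is `m + a X` and the height is `b Y`, with `X² + Y⁴ = 1`. -/
noncomputable def tubeMap (m a b : ℝ → ℝ) (x : ℝ × ℝ) : Fin 4 → ℝ :=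
  ![1, √(tubeSq m a x) * Real.cos (2 * Real.pi * x.1),
    √(tubeSq m a x) * Real.sin (2 * Real.pi * x.1),
    b (2 * Real.pi * x.1) * (ovalRadius (2 * Real.pi * x.2) * Real.sin (2 * Real.pi * x.2))]

theorem tubeMap_ne_zero (m a b : ℝ → ℝ) (x : ℝ × ℝ) : tubeMap m a b x ≠ 0 := fun h =>
  one_ne_zero (congrFun h 0 : (1 : ℝ) = 0)

/-- On the oval `X ≥ -1`, so `m + a X ≥ m - a > 0`: the tube misses the axis. -/
theorem IsTube.tubeSq_pos {m a b : ℝ → ℝ} (h : IsTube m a b) (x : ℝ × ℝ) : 0 < tubeSq m a x := by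
  have h1 := ovalRadius_equation (2 * Real.pi * x.2)
  have h2 := h.width_pos (2 * Real.pi * x.1)
  have h3 := h.width_lt_center (2 * Real.pi * x.1)
  unfold tubeSq
  set X := ovalRadius (2 * Real.pi * x.2) * Real.cos (2 * Real.pi * x.2)
  have hX : -1 ≤ X := by
    have : X ^ 2 ≤ 1 := by
      have := Even.pow_nonneg (n := 4) (by decide)
        (ovalRadius (2 * Real.pi * x.2) * Real.sin (2 * Real.pi * x.2))
      linarith
    exact (abs_le.1 ((sq_le_one_iff_abs_le_one X).1 this)).1
  have := mul_le_mul_of_nonneg_left hX h2.le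
  linarith

theorem ovalRadius_add_int (φ : ℝ) (n : ℤ) :
    ovalRadius (φ + n * (2 * Real.pi)) = ovalRadius φ := by
  simp only [ovalRadius, Real.cos_add_int_mul_two_pi, Real.sin_add_int_mul_two_pi]

theorem IsTube.tubeMap_add_int {m a b : ℝ → ℝ} (h : IsTube m a b) (x : ℝ × ℝ) (k l : ℤ) :
    tubeMap m a b (x + ((k : ℝ), (l : ℝ))) = tubeMap m a b x := by
  have h1 : 2 * Real.pi * (x + ((k : ℝ), (l : ℝ))).1 = 2 * Real.pi * x.1 + k * (2 * Real.pi) := by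
    simp only [Prod.fst_add]; ring
  have h2 : 2 * Real.pi * (x + ((k : ℝ), (l : ℝ))).2 = 2 * Real.pi * x.2 + l * (2 * Real.pi) := by
    simp only [Prod.snd_add]; ring
  unfold tubeMap tubeSq
  rw [h1, h2, h.periodic_center.int_mul k _, h.periodic_width.int_mul k _,
    h.periodic_height.int_mul k _, ovalRadius_add_int, Real.cos_add_int_mul_two_pi,
    Real.sin_add_int_mul_two_pi, Real.cos_add_int_mul_two_pi, Real.sin_add_int_mul_two_pi]

theorem IsTube.exists_int_of_tubeMap_eq {m a b : ℝ → ℝ} (h : IsTube m a b) {x y : ℝ × ℝ}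
    (heq : tubeMap m a b y = tubeMap m a b x) : ∃ k l : ℤ, y = x + ((k : ℝ), (l : ℝ)) := by
  have hpi := Real.pi_pos
  have e1 : √(tubeSq m a y) * Real.cos (2 * Real.pi * y.1) =
      √(tubeSq m a x) * Real.cos (2 * Real.pi * x.1) := congrFun heq 1
  have e2 : √(tubeSq m a y) * Real.sin (2 * Real.pi * y.1) =
      √(tubeSq m a x) * Real.sin (2 * Real.pi * x.1) := congrFun heq 2
  have e3 := congrFun heq 3
  simp only [tubeMap, Matrix.cons_val] at e3
  obtain ⟨hr, hc, hs⟩ := eq_of_polar_eq (Real.sqrt_pos.2 (h.tubeSq_pos x))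
    (Real.sqrt_pos.2 (h.tubeSq_pos y)) e1 e2
  obtain ⟨k, hk⟩ := exists_int_of_cos_sin_eq hc hs
  have hk' : 2 * Real.pi * y.1 = 2 * Real.pi * x.1 + k * (2 * Real.pi) := by rw [hk]; ring
  have hm : m (2 * Real.pi * y.1) = m (2 * Real.pi * x.1) := by
    rw [hk', h.periodic_center.int_mul k _]
  have ha : a (2 * Real.pi * y.1) = a (2 * Real.pi * x.1) := by
    rw [hk', h.periodic_width.int_mul k _]
  have hb : b (2 * Real.pi * y.1) = b (2 * Real.pi * x.1) := by
    rw [hk', h.periodic_height.int_mul k _]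
  have hsq : tubeSq m a y = tubeSq m a x := by
    rw [← Real.sq_sqrt (h.tubeSq_pos y).le, ← Real.sq_sqrt (h.tubeSq_pos x).le, hr]
  unfold tubeSq at hsq
  rw [hm, ha, add_right_inj] at hsq
  rw [hb] at e3
  obtain ⟨-, hc', hs'⟩ := eq_of_polar_eq (ovalRadius_pos _) (ovalRadius_pos _)
    (mul_left_cancel₀ (h.width_pos _).ne' hsq) (mul_left_cancel₀ (h.height_pos _).ne' e3)
  obtain ⟨l, hl⟩ := exists_int_of_cos_sin_eq hc' hs'
  refine ⟨k, l, ?_⟩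
  ext
  · simp only [Prod.fst_add]
    apply mul_left_cancel₀ (mul_pos two_pos hpi).ne'; rw [hk]; ring
  · simp only [Prod.snd_add]
    apply mul_left_cancel₀ (mul_pos two_pos hpi).ne'; rw [hl]; ring

theorem IsTube.contDiff_tubeSq {m a b : ℝ → ℝ} (h : IsTube m a b) : ContDiff ℝ ∞ (tubeSq m a) := by
  have h1 := h.contDiff_center
  have h2 := h.contDiff_width
  have h4 := contDiff_ovalRadius
  unfold tubeSq
  fun_prop

/-- The tangential part in the `X₁X₂`-plane kills `w.1`. The angle around the axis is then constant
along the line, and what remains is the derivative of the oval in polar coordinates, which kills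
`w.2`. -/
theorem IsTube.immersion {m a b : ℝ → ℝ} (h : IsTube m a b) {x w : ℝ × ℝ}
    (hd : HasDerivAt (fun τ : ℝ => tubeMap m a b (x + τ • w)) 0 0) : w = 0 := by
  have hpi : (2 * Real.pi) ≠ 0 := (mul_pos two_pos Real.pi_pos).ne'
  have hcomp := hasDerivAt_pi.1 hd
  have hline : HasDerivAt (fun τ : ℝ => x + τ • w) w 0 := by
    simpa using ((hasDerivAt_id (0 : ℝ)).smul_const w).const_add x
  have hθ : HasDerivAt (fun τ : ℝ => 2 * Real.pi * (x + τ • w).1) (2 * Real.pi * w.1) 0 := by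
    simpa using (((hasDerivAt_id (0 : ℝ)).mul_const w.1).const_add x.1).const_mul (2 * Real.pi)
  have hφ : HasDerivAt (fun τ : ℝ => 2 * Real.pi * (x + τ • w).2) (2 * Real.pi * w.2) 0 := by
    simpa using (((hasDerivAt_id (0 : ℝ)).mul_const w.2).const_add x.2).const_mul (2 * Real.pi)
  have hsq : ContDiff ℝ ∞ fun x => √(tubeSq m a x) :=
    h.contDiff_tubeSq.sqrt fun x => (h.tubeSq_pos x).ne'
  obtain ⟨u', hu⟩ : ∃ u', HasDerivAt (fun τ : ℝ => √(tubeSq m a (x + τ • w))) u' 0 :=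
    ⟨_, ((hsq.differentiable (by simp) _).hasFDerivAt.comp_hasDerivAt 0 hline)⟩
  have d1 := (hcomp 1).unique (hu.mul hθ.cos)
  have d2 := (hcomp 2).unique (hu.mul hθ.sin)
  simp only [zero_smul, add_zero, Pi.zero_apply] at d1 d2
  obtain ⟨hu0, hB⟩ := eq_zero_of_rotation (a := 2 * Real.pi * x.1) (A := u')
    (B := √(tubeSq m a x) * (2 * Real.pi * w.1)) (by linear_combination -d1)
    (by linear_combination -d2)
  have hw1 : w.1 = 0 := (mul_eq_zero.1 ((mul_eq_zero.1 hB).resolve_left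
    (Real.sqrt_pos.2 (h.tubeSq_pos x)).ne')).resolve_left hpi
  obtain ⟨r', hr⟩ : ∃ r', HasDerivAt (fun τ : ℝ => ovalRadius (2 * Real.pi * (x + τ • w).2)) r' 0 :=
    ⟨_, ((contDiff_ovalRadius.differentiable (by simp) _).hasDerivAt.comp 0 hφ)⟩
  have hX := hr.mul hφ.cos
  have hY := hr.mul hφ.sin
  have hfst : ∀ τ : ℝ, (x + τ • w).1 = x.1 := fun τ => by simp [hw1]
  have dX := ((hX.const_mul (a (2 * Real.pi * x.1))).const_add (m (2 * Real.pi * x.1)))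
  -- The derivative `u'` of the distance from the axis is zero, hence so is that of its square,
  -- which is affine in the oval coordinate `X`.
  have hu2 : HasDerivAt (fun τ : ℝ => tubeSq m a (x + τ • w)) 0 0 := by
    have := hu.pow 2
    rw [hu0, mul_zero] at this
    refine this.congr_of_eventuallyEq (.of_forall fun τ => ?_)
    exact (Real.sq_sqrt (h.tubeSq_pos _).le).symm
  have eX := hu2.unique (dX.congr_of_eventuallyEq (.of_forall fun τ => by
    simp only [tubeSq, hfst]; rfl))
  have eY := (hcomp 3).unique ((hY.const_mul (b (2 * Real.pi * x.1))).congr_of_eventuallyEq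
    (.of_forall fun τ => by simp only [tubeMap, Matrix.cons_val, hfst]; rfl))
  simp only [zero_smul, add_zero, Pi.zero_apply] at eX eY
  have eX' := (mul_eq_zero.1 eX.symm).resolve_left (h.width_pos _).ne'
  have eY' := (mul_eq_zero.1 eY.symm).resolve_left (h.height_pos _).ne'
  have hC := (eq_zero_of_rotation (a := 2 * Real.pi * x.2) (A := r')
    (B := ovalRadius (2 * Real.pi * x.2) * (2 * Real.pi * w.2)) (by linear_combination eX')
    (by linear_combination eY')).2
  have hw2 : w.2 = 0 := (mul_eq_zero.1 ((mul_eq_zero.1 hC).resolve_left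
    (ovalRadius_pos _).ne')).resolve_left hpi
  exact Prod.ext hw1 hw2

/-- The torus in `RP3` parametrized by `tubeMap`. -/
def tubeTorus (m a b : ℝ → ℝ) : Set RP3 :=
  Set.range fun x => Projectivization.mk ℝ (tubeMap m a b x) (tubeMap_ne_zero m a b x)

theorem IsTube.isTorus {m a b : ℝ → ℝ} (h : IsTube m a b) : IsTorus (tubeTorus m a b) := by
  have h0 := h.contDiff_height
  have hsq : ContDiff ℝ ∞ fun x => √(tubeSq m a x) :=
    h.contDiff_tubeSq.sqrt fun x => (h.tubeSq_pos x).ne'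
  have h4 := contDiff_ovalRadius
  refine isTorus_range (tubeMap_ne_zero m a b) ?_ ?_ fun x y => ?_
  · rw [contDiff_pi]
    intro i
    fin_cases i
    · exact contDiff_const
    · exact hsq.mul (by fun_prop)
    · exact hsq.mul (by fun_prop)
    · change ContDiff ℝ ∞ fun x : ℝ × ℝ => b (2 * Real.pi * x.1) *
        (ovalRadius (2 * Real.pi * x.2) * Real.sin (2 * Real.pi * x.2))
      fun_prop
  · intro x w c F' hF' hc
    have d0 : F' 0 = 0 := (hasDerivAt_pi.1 hF' 0).unique (hasDerivAt_const (0 : ℝ) (1 : ℝ))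
    have e0 : c * 1 + F' 0 = 0 := congrFun hc 0
    have hc0 : c = 0 := by linarith
    rw [hc0, zero_smul, zero_add] at hc
    rw [hc] at hF'
    exact h.immersion hF'
  · rw [Projectivization.mk_eq_mk_iff']
    constructor
    · rintro ⟨c, hc⟩
      have hc1 : c * 1 = 1 := congrFun hc 0
      rw [mul_one] at hc1
      rw [hc1, one_smul] at hc
      exact h.exists_int_of_tubeMap_eq hc
    · rintro ⟨k, l, rfl⟩
      exact ⟨1, by rw [one_smul, h.tubeMap_add_int]⟩

/-- The first hypothesis puts the real locus in the chart `X₀ = 1`. There the rescaled pair `((A² -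
m)/a, w/b)` lies on the oval, and its polar angle is the second tube parameter. -/
theorem IsTube.realLocus_eq {m a b : ℝ → ℝ} (h : IsTube m a b) {P : Quartic}
    (h0 : ∀ x, x ≠ 0 → value P x = 0 → x 0 ≠ 0)
    (hP : ∀ A θ w : ℝ, value P ![1, A * Real.cos θ, A * Real.sin θ, w] = 0 ↔
      ((A ^ 2 - m θ) / a θ) ^ 2 + (w / b θ) ^ 4 = 1) : realLocus P = tubeTorus m a b := by
  have hpi : (2 * Real.pi) ≠ 0 := (mul_pos two_pos Real.pi_pos).ne'
  ext p
  constructor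
  · induction p using Projectivization.ind with
    | h x hx =>
      intro hp
      rw [mk_mem_realLocus] at hp
      have hx0 := h0 x hx hp
      obtain ⟨A, θ, hA, h1, h2⟩ := exists_polar ((x 0)⁻¹ * x 1) ((x 0)⁻¹ * x 2)
      have hx' : (x 0)⁻¹ • x = ![1, A * Real.cos θ, A * Real.sin θ, (x 0)⁻¹ * x 3] := by
        ext i
        fin_cases i
        · exact inv_mul_cancel₀ hx0
        · exact h1
        · exact h2
        · rfl
      have hp' : value P ((x 0)⁻¹ • x) = 0 := by rw [value_smul, hp, mul_zero]
      rw [hx', hP] at hp'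
      obtain ⟨r, φ, hr, hX, hY⟩ := exists_polar ((A ^ 2 - m θ) / a θ) ((x 0)⁻¹ * x 3 / b θ)
      rw [hX, hY] at hp'
      have hr' := eq_ovalRadius hr hp'
      have ha := (h.width_pos θ).ne'
      have hb := (h.height_pos θ).ne'
      refine ⟨(θ / (2 * Real.pi), φ / (2 * Real.pi)), ?_⟩
      refine ((Projectivization.mk_eq_mk_iff' ℝ _ _ _ _).2 ⟨x 0, ?_⟩).symm
      have hmap : tubeMap m a b (θ / (2 * Real.pi), φ / (2 * Real.pi)) = (x 0)⁻¹ • x := by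
        rw [hx']
        simp only [tubeMap, tubeSq, mul_div_cancel₀ _ hpi, ← hr', ← hX, ← hY]
        rw [mul_div_cancel₀ _ ha, mul_div_cancel₀ _ hb, add_sub_cancel, Real.sqrt_sq hA]
      rw [hmap, smul_smul, mul_inv_cancel₀ hx0, one_smul]
  · rintro ⟨x, rfl⟩
    refine (mk_mem_realLocus _).2 ((hP _ _ _).2 ?_)
    have ha := (h.width_pos (2 * Real.pi * x.1)).ne'
    have hb := (h.height_pos (2 * Real.pi * x.1)).ne'
    rw [Real.sq_sqrt (h.tubeSq_pos x).le, tubeSq, add_sub_cancel_left, mul_div_cancel_left₀ _ ha,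
      mul_div_cancel_left₀ _ hb]
    exact ovalRadius_equation _

/-- A quartic which in the affine chart `X₀ = 1` takes the form `α A⁴ - 2 c A² + d + X₃⁴` in
cylindrical coordinates has a single contractible torus as its real locus. -/
theorem hasOneContractibleTorus_of_tube {P : Quartic} {α : ℝ → ℝ} {c d : ℝ}
    (hα : ContDiff ℝ ∞ α) (hper : Function.Periodic α (2 * Real.pi)) (hpos : ∀ θ, 0 < α θ)
    (hc : 0 < c) (hd : 0 < d) (hdisc : ∀ θ, d * α θ < c ^ 2)
    (h0 : ∀ x, x ≠ 0 → value P x = 0 → x 0 ≠ 0)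
    (hP : ∀ A θ w : ℝ, value P ![1, A * Real.cos θ, A * Real.sin θ, w] =
      α θ * A ^ 4 - 2 * c * A ^ 2 + d + w ^ 4) : HasOneContractibleTorus P := by
  have hm : ContDiff ℝ ∞ fun θ => c / α θ := contDiff_const.div hα fun θ => (hpos θ).ne'
  have he : ContDiff ℝ ∞ fun θ => c ^ 2 / α θ - d :=
    (contDiff_const.div hα fun θ => (hpos θ).ne').sub contDiff_const
  have he0 : ∀ θ, 0 < c ^ 2 / α θ - d := fun θ => by
    rw [sub_pos, lt_div_iff₀ (hpos θ)]
    exact hdisc θ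
  have hea : ∀ θ, 0 < (c ^ 2 / α θ - d) / α θ := fun θ => div_pos (he0 θ) (hpos θ)
  -- With `e = c²/α - d`, completing the square turns the equation into `α (A² - c/α)² + w⁴ = e`;
  -- this dictates centre `c/α`, width `√(e/α)` and height `e^(1/4)`.
  have htube : IsTube (fun θ => c / α θ) (fun θ => √((c ^ 2 / α θ - d) / α θ))
      (fun θ => √√(c ^ 2 / α θ - d)) :=
    { contDiff_center := hm
      contDiff_width := (he.div hα fun θ => (hpos θ).ne').sqrt fun θ => (hea θ).ne'
      contDiff_height := (he.sqrt fun θ => (he0 θ).ne').sqrt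
        fun θ => (Real.sqrt_pos.2 (he0 θ)).ne'
      periodic_center := fun θ => by simp only [hper θ]
      periodic_width := fun θ => by simp only [hper θ]
      periodic_height := fun θ => by simp only [hper θ]
      width_pos := fun θ => Real.sqrt_pos.2 (hea θ)
      height_pos := fun θ => Real.sqrt_pos.2 (Real.sqrt_pos.2 (he0 θ))
      -- `e/α = (c/α)² - d/α`, which is below `(c/α)²` exactly because `d > 0`.
      width_lt_center := fun θ => by
        have := hpos θ
        rw [Real.sqrt_lt' (by positivity), div_pow, sq (α θ), ← div_div]
        gcongr
        linarith }
  have hloc := htube.realLocus_eq h0 fun A θ w => by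
    have h1 := hpos θ
    have h2 := he0 θ
    have h4 : √√(c ^ 2 / α θ - d) ^ 4 = c ^ 2 / α θ - d := by
      rw [show (4 : ℕ) = 2 * 2 by norm_num, pow_mul, Real.sq_sqrt (Real.sqrt_nonneg _),
        Real.sq_sqrt h2.le]
    have key : α θ * A ^ 4 - 2 * c * A ^ 2 + d + w ^ 4 =
        α θ * (A ^ 2 - c / α θ) ^ 2 + w ^ 4 - (c ^ 2 / α θ - d) := by
      field_simp
      ring
    rw [hP, div_pow, div_pow, h4, Real.sq_sqrt (hea θ).le, key, sub_eq_zero,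
      div_div_eq_mul_div, ← add_div, div_eq_one_iff_eq h2.ne', mul_comm (α θ)]
  refine ⟨hloc ▸ htube.isTorus, contractibleIn_of_affine fun x hx hxL => ?_⟩
  exact h0 x hx ((mk_mem_realLocus hx).1 hxL)

/-! ### The example quartics and their values -/

theorem mem_torusQuartics {P : Quartic} {L : Set RP3} (hL : IsTorus L) (hLP : L ⊆ realLocus P)
    (hS : Disjoint (Set.range realPoints) (singularLocus P)) : P ∈ torusQuartics :=
  ⟨L, hL, hLP, hS.mono_left (Set.image_subset_range _ _)⟩

theorem mem_torusQuartics_of_smooth {P : Quartic} {L : Set RP3} (hL : IsTorus L)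
    (hLP : L ⊆ realLocus P) (hS : P ∈ smoothQuartics) : P ∈ torusQuartics :=
  mem_torusQuartics hL hLP (by
    rw [show singularLocus P = ∅ from hS]
    exact Set.disjoint_empty _)

/-- `cos⁴ + sin⁴` -/
noncomputable def quarticCircle (θ : ℝ) : ℝ := Real.cos θ ^ 4 + Real.sin θ ^ 4

theorem half_le_quarticCircle (θ : ℝ) : 1 / 2 ≤ quarticCircle θ := by
  have h := Real.sin_sq_add_cos_sq θ
  unfold quarticCircle
  nlinarith [sq_nonneg (Real.cos θ ^ 2 - Real.sin θ ^ 2)]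

theorem quarticCircle_pos (θ : ℝ) : 0 < quarticCircle θ := by
  linarith [half_le_quarticCircle θ]

theorem quarticCircle_le_one (θ : ℝ) : quarticCircle θ ≤ 1 := by
  have h := Real.sin_sq_add_cos_sq θ
  unfold quarticCircle
  nlinarith [mul_nonneg (sq_nonneg (Real.cos θ)) (sq_nonneg (Real.sin θ))]

theorem contDiff_quarticCircle : ContDiff ℝ ∞ quarticCircle := by
  unfold quarticCircle
  fun_prop

theorem quarticCircle_add_pi (θ : ℝ) : quarticCircle (θ + Real.pi) = quarticCircle θ := by
  simp only [quarticCircle, Real.cos_add_pi, Real.sin_add_pi]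
  ring

theorem quarticCircle_add_two_pi (θ : ℝ) : quarticCircle (θ + 2 * Real.pi) = quarticCircle θ := by
  simp only [quarticCircle, Real.cos_add_two_pi, Real.sin_add_two_pi]

theorem value_fermatQuartic (x : Fin 4 → ℝ) :
    value fermatQuartic x = x 0 ^ 4 + x 1 ^ 4 - x 2 ^ 4 - x 3 ^ 4 := by
  simp [value, fermatQuartic]

theorem value_productQuartic (r₁ r₂ : ℝ) (x : Fin 4 → ℝ) :
    value (productQuartic r₁ r₂) x = (x 0 ^ 2 + x 1 ^ 2 - r₁ * (x 2 ^ 2 + x 3 ^ 2)) *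
      (x 0 ^ 2 + x 1 ^ 2 - r₂ * (x 2 ^ 2 + x 3 ^ 2)) := by
  simp [value, productQuartic]

theorem value_revolutionQuartic (ε : ℝ) (x : Fin 4 → ℝ) :
    value (revolutionQuartic ε) x =
      (x 1 ^ 2 + x 2 ^ 2 - x 0 ^ 2) ^ 2 + x 3 ^ 4 - ε * x 0 ^ 4 := by
  simp [value, revolutionQuartic]

/-- `X₀⁴ + X₁⁴ + X₂⁴ + X₃⁴ - 3 (X₀² + X₁²) (X₂² + X₃²)` -/
noncomputable def smoothPairQuartic : Quartic :=
  ⟨X 0 ^ 4 + X 1 ^ 4 + X 2 ^ 4 + X 3 ^ 4 - C 3 * ((X 0 ^ 2 + X 1 ^ 2) * (X 2 ^ 2 + X 3 ^ 2)), by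
    have h (i : Fin 4) (k : ℕ) : (X i ^ k : MvPolynomial (Fin 4) ℝ).IsHomogeneous k := by
      simpa using (isHomogeneous_X ℝ i).pow k
    exact ((((h 0 4).add (h 1 4)).add (h 2 4)).add (h 3 4)).sub
      ((((h 0 2).add (h 1 2)).mul ((h 2 2).add (h 3 2))).C_mul 3)⟩

/-- `X₀⁴ + X₁⁴ + X₂⁴ + X₃⁴ - 4 (X₁² + X₂²) X₀²` -/
noncomputable def smoothTubeQuartic : Quartic :=
  ⟨X 0 ^ 4 + X 1 ^ 4 + X 2 ^ 4 + X 3 ^ 4 - C 4 * ((X 1 ^ 2 + X 2 ^ 2) * X 0 ^ 2), by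
    have h (i : Fin 4) (k : ℕ) : (X i ^ k : MvPolynomial (Fin 4) ℝ).IsHomogeneous k := by
      simpa using (isHomogeneous_X ℝ i).pow k
    exact ((((h 0 4).add (h 1 4)).add (h 2 4)).add (h 3 4)).sub
      ((((h 1 2).add (h 2 2)).mul (h 0 2)).C_mul 4)⟩

theorem value_smoothPairQuartic (x : Fin 4 → ℝ) : value smoothPairQuartic x =
    x 0 ^ 4 + x 1 ^ 4 + x 2 ^ 4 + x 3 ^ 4 - 3 * ((x 0 ^ 2 + x 1 ^ 2) * (x 2 ^ 2 + x 3 ^ 2)) := by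
  simp [value, smoothPairQuartic]

theorem value_smoothTubeQuartic (x : Fin 4 → ℝ) : value smoothTubeQuartic x =
    x 0 ^ 4 + x 1 ^ 4 + x 2 ^ 4 + x 3 ^ 4 - 4 * ((x 1 ^ 2 + x 2 ^ 2) * x 0 ^ 2) := by
  simp [value, smoothTubeQuartic]

/-! ### Smoothness of the three representatives -/

theorem fermatQuartic_smooth : fermatQuartic ∈ smoothQuartics := by
  refine Set.eq_empty_of_forall_notMem ?_
  rintro _ ⟨z, hz, -, h, -⟩
  have h0 := h 0
  have h1 := h 1
  have h2 := h 2
  have h3 := h 3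
  simp [fermatQuartic, pderiv_X] at h0 h1 h2 h3
  exact hz (by ext i; fin_cases i <;> assumption)

/-- Each equation forces `w² = 0` or `w² = cS`; `k` counts the second case. This makes the critical
equations below linear in sums of squares, with integer parameters. -/
theorem exists_sum_sq_eq_mul {w₁ w₂ c S : ℂ} (h₁ : w₁ ^ 3 = c * S * w₁) (h₂ : w₂ ^ 3 = c * S * w₂) :
    ∃ k : ℕ, k ≤ 2 ∧ w₁ ^ 2 + w₂ ^ 2 = k * c * S := by
  have key : ∀ w : ℂ, w ^ 3 = c * S * w → w ^ 2 = 0 ∨ w ^ 2 = c * S := fun w h => by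
    rcases eq_or_ne w 0 with rfl | hw
    · left; norm_num
    · right
      apply mul_right_cancel₀ hw
      rw [← h]
      ring
  rcases key _ h₁ with e₁ | e₁ <;> rcases key _ h₂ with e₂ | e₂ <;> rw [e₁, e₂]
  · exact ⟨0, by norm_num, by norm_num⟩
  · exact ⟨1, by norm_num, by push_cast; ring⟩
  · exact ⟨1, by norm_num, by push_cast; ring⟩
  · exact ⟨2, by norm_num, by push_cast; ring⟩

theorem smoothPairQuartic_smooth : smoothPairQuartic ∈ smoothQuartics := by
  refine Set.eq_empty_of_forall_notMem ?_
  rintro _ ⟨z, hz, -, h, -⟩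
  have h0 := h 0
  have h1 := h 1
  have h2 := h 2
  have h3 := h 3
  simp [smoothPairQuartic, pderiv_X] at h0 h1 h2 h3
  obtain ⟨k, hk2, hk⟩ := exists_sum_sq_eq_mul (w₁ := z 0) (w₂ := z 1) (c := 3 / 2)
    (S := z 2 ^ 2 + z 3 ^ 2) (by linear_combination h0 / 4) (by linear_combination h1 / 4)
  obtain ⟨l, hl2, hl⟩ := exists_sum_sq_eq_mul (w₁ := z 2) (w₂ := z 3) (c := 3 / 2)
    (S := z 0 ^ 2 + z 1 ^ 2) (by linear_combination h2 / 4) (by linear_combination h3 / 4)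
  -- The two relations combine to `(1 - 9kl/4)(z₀² + z₁²) = 0`, and `kl = 4/9` is impossible for
  -- integers.
  have hA : z 0 ^ 2 + z 1 ^ 2 = 0 := by
    have : (1 - k * l * (9 / 4) : ℂ) * (z 0 ^ 2 + z 1 ^ 2) = 0 := by
      linear_combination hk + (k * (3 / 2) : ℂ) * hl
    refine (mul_eq_zero.1 this).resolve_left ?_
    interval_cases k <;> interval_cases l <;> norm_num
  rw [hA, mul_zero] at hl
  rw [hl, zero_mul, mul_zero, sub_zero] at h0 h1
  rw [hA, zero_mul, mul_zero, sub_zero] at h2 h3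
  refine hz (funext fun i => ?_)
  fin_cases i
  exacts [by simpa using h0, by simpa using h1, by simpa using h2, by simpa using h3]

theorem smoothTubeQuartic_smooth : smoothTubeQuartic ∈ smoothQuartics := by
  refine Set.eq_empty_of_forall_notMem ?_
  rintro _ ⟨z, hz, -, h, -⟩
  have h0 := h 0
  have h1 := h 1
  have h2 := h 2
  have h3 := h 3
  simp [smoothTubeQuartic, pderiv_X] at h0 h1 h2 h3
  obtain ⟨k, hk2, hk⟩ := exists_sum_sq_eq_mul (w₁ := z 1) (w₂ := z 2) (c := 2)
    (S := z 0 ^ 2) (by linear_combination h1 / 4) (by linear_combination h2 / 4)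
  -- Here `∂₀P = 0` becomes `(1 - 4k) z₀³ = 0` with `k` an integer.
  have hz0 : z 0 = 0 := by
    have : (1 - 4 * k : ℂ) * z 0 ^ 3 = 0 := by
      linear_combination h0 / 4 + 2 * z 0 * hk
    refine pow_eq_zero_iff (n := 3) (by norm_num) |>.1 ((mul_eq_zero.1 this).resolve_left ?_)
    interval_cases k <;> norm_num
  rw [hz0] at h1 h2
  refine hz (funext fun i => ?_)
  fin_cases i
  exacts [hz0, by simpa using h1, by simpa using h2, h3]

/-! ### Real loci: essential tori -/

theorem sq_eq_mul_sq_iff {A B s : ℝ} (hA : 0 ≤ A) (hB : 0 ≤ B) (hs : 0 ≤ s) :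
    A ^ 2 = s * B ^ 2 ↔ A = √s * B := by
  rw [← sq_eq_sq₀ hA (by positivity), mul_pow, Real.sq_sqrt hs]

theorem isRadius_sqrt {s : ℝ × ℝ → ℝ} (hs : ContDiff ℝ ∞ s) (hpos : ∀ x, 0 < s x)
    (h1 : ∀ a b, s (a + Real.pi, b) = s (a, b)) (h2 : ∀ a b, s (a, b + Real.pi) = s (a, b)) :
    IsRadius fun x => √(s x) where
  contDiff := hs.sqrt fun x => (hpos x).ne'
  pos x := Real.sqrt_pos.2 (hpos x)
  periodic_fst a b := by rw [h1]
  periodic_snd a b := by rw [h2]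

/-- With `q = cos⁴ + sin⁴` the equation reads `q(θ) A⁴ = q(φ) B⁴`, so the radius function is the
fourth root of `q(φ)/q(θ)`. -/
theorem hasOneEssentialTorus_fermatQuartic : HasOneEssentialTorus fermatQuartic := by
  have hpos : ∀ x : ℝ × ℝ, 0 < quarticCircle x.2 / quarticCircle x.1 := fun x =>
    div_pos (quarticCircle_pos _) (quarticCircle_pos _)
  have hs : ContDiff ℝ ∞ fun x : ℝ × ℝ => quarticCircle x.2 / quarticCircle x.1 :=
    (contDiff_quarticCircle.comp contDiff_snd).div (contDiff_quarticCircle.comp contDiff_fst)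
      fun x => (quarticCircle_pos _).ne'
  have hρ : IsRadius fun x : ℝ × ℝ => √√(quarticCircle x.2 / quarticCircle x.1) :=
    isRadius_sqrt (hs.sqrt fun x => (hpos x).ne') (fun x => Real.sqrt_pos.2 (hpos x))
      (fun a b => by simp only [quarticCircle_add_pi])
      (fun a b => by simp only [quarticCircle_add_pi])
  have hloc := realLocus_eq_cliffordTorus_union (P := fermatQuartic) (fun A B θ φ hA hB => by
    rw [or_self, ← sq_eq_mul_sq_iff hA hB (Real.sqrt_nonneg _),
      ← sq_eq_mul_sq_iff (sq_nonneg A) (sq_nonneg B) (hpos (θ, φ)).le, value_fermatQuartic,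
      div_mul_eq_mul_div, eq_div_iff (quarticCircle_pos θ).ne', ← sub_eq_zero (b := _ * _)]
    refine Eq.congr_left ?_
    simp only [quarticCircle, Matrix.cons_val]
    ring) hρ.pos hρ.pos
  rw [Set.union_self] at hloc
  rw [HasOneEssentialTorus, hloc]
  exact ⟨isTorus_cliffordTorus hρ, not_contractibleIn_cliffordTorus hρ⟩

theorem isRadius_const {r : ℝ} (hr : 0 < r) : IsRadius fun _ => √r :=
  isRadius_sqrt contDiff_const (fun _ => hr) (fun _ _ => rfl) fun _ _ => rfl

theorem hasTwoEssentialTori_of_clifford {P : Quartic} {ρ ρ' : ℝ × ℝ → ℝ} (hρ : IsRadius ρ)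
    (hρ' : IsRadius ρ') (hloc : realLocus P = cliffordTorus ρ ∪ cliffordTorus ρ')
    (hne : ∀ x y, ρ x ≠ ρ' y) : HasTwoEssentialTori P :=
  ⟨_, _, isTorus_cliffordTorus hρ, isTorus_cliffordTorus hρ',
    disjoint_cliffordTorus hρ.pos hρ'.pos hne, hloc, not_contractibleIn_cliffordTorus hρ,
    not_contractibleIn_cliffordTorus hρ'⟩

theorem hasTwoEssentialTori_productQuartic {r₁ r₂ : ℝ} (h₁ : 0 < r₁) (h₂ : r₁ < r₂) :
    HasTwoEssentialTori (productQuartic r₁ r₂) := by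
  have hr₂ := h₁.trans h₂
  refine hasTwoEssentialTori_of_clifford (isRadius_const h₁) (isRadius_const hr₂)
    (realLocus_eq_cliffordTorus_union (fun A B θ φ hA hB => ?_) (isRadius_const h₁).pos
      (isRadius_const hr₂).pos) fun _ _ => (Real.sqrt_lt_sqrt h₁.le h₂).ne
  have h1 : (A * Real.cos θ) ^ 2 + (A * Real.sin θ) ^ 2 = A ^ 2 := by
    linear_combination A ^ 2 * Real.sin_sq_add_cos_sq θ
  have h2 : (B * Real.cos φ) ^ 2 + (B * Real.sin φ) ^ 2 = B ^ 2 := by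
    linear_combination B ^ 2 * Real.sin_sq_add_cos_sq φ
  rw [← sq_eq_mul_sq_iff hA hB h₁.le, ← sq_eq_mul_sq_iff hA hB hr₂.le, value_productQuartic]
  simp only [Matrix.cons_val, h1, h2, mul_eq_zero, sub_eq_zero]

/-- With `q = cos⁴ + sin⁴` and `t = A²/B²` the equation is `q(θ) t² - 3t + q(φ) = 0`. Since `1/2 ≤ q
≤ 1`, its discriminant `D` is positive, both roots are positive, and they lie strictly on either
side of `t = 1`. The last fact keeps the two tori disjoint. -/
theorem hasTwoEssentialTori_smoothPairQuartic : HasTwoEssentialTori smoothPairQuartic := by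
  set D : ℝ × ℝ → ℝ := fun x => 9 - 4 * (quarticCircle x.1 * quarticCircle x.2) with hD
  have hDpos : ∀ x, 0 < D x := fun x => by
    have := mul_le_one₀ (quarticCircle_le_one x.1) (quarticCircle_pos x.2).le
      (quarticCircle_le_one x.2)
    simp only [hD]
    linarith
  have hDlt : ∀ x, √(D x) < 3 := fun x => by
    rw [Real.sqrt_lt' (by norm_num)]
    have := mul_pos (quarticCircle_pos x.1) (quarticCircle_pos x.2)
    simp only [hD]
    linarith
  have h1 : ContDiff ℝ ∞ fun x : ℝ × ℝ => quarticCircle x.1 :=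
    contDiff_quarticCircle.comp contDiff_fst
  have h2 : ContDiff ℝ ∞ fun x : ℝ × ℝ => quarticCircle x.2 :=
    contDiff_quarticCircle.comp contDiff_snd
  have hDs : ContDiff ℝ ∞ fun x => √(D x) :=
    ContDiff.sqrt (contDiff_const.sub (contDiff_const.mul (h1.mul h2))) fun x => (hDpos x).ne'
  have hα : ∀ x : ℝ × ℝ, 0 < 2 * quarticCircle x.1 := fun x =>
    mul_pos two_pos (quarticCircle_pos _)
  have hp1 : ∀ x, 0 < (3 + √(D x)) / (2 * quarticCircle x.1) := fun x =>
    div_pos (by positivity) (hα x)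
  have hp2 : ∀ x, 0 < (3 - √(D x)) / (2 * quarticCircle x.1) := fun x =>
    div_pos (sub_pos.2 (hDlt x)) (hα x)
  have hρ : IsRadius fun x => √((3 - √(D x)) / (2 * quarticCircle x.1)) :=
    isRadius_sqrt ((contDiff_const.sub hDs).div (contDiff_const.mul h1) fun x => (hα x).ne') hp2
      (fun a b => by simp only [hD, quarticCircle_add_pi])
      (fun a b => by simp only [hD, quarticCircle_add_pi])
  have hρ' : IsRadius fun x => √((3 + √(D x)) / (2 * quarticCircle x.1)) :=
    isRadius_sqrt ((contDiff_const.add hDs).div (contDiff_const.mul h1) fun x => (hα x).ne') hp1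
      (fun a b => by simp only [hD, quarticCircle_add_pi])
      (fun a b => by simp only [hD, quarticCircle_add_pi])
  refine hasTwoEssentialTori_of_clifford hρ hρ' (realLocus_eq_cliffordTorus_union
    (fun A B θ φ hA hB => ?_) hρ.pos hρ'.pos) fun x y => ne_of_lt ?_
  · rw [← sq_eq_mul_sq_iff hA hB (hp1 _).le, ← sq_eq_mul_sq_iff hA hB (hp2 _).le,
      ← sub_eq_zero (a := A ^ 2), ← sub_eq_zero (a := A ^ 2), ← mul_eq_zero]
    have hq := Real.sq_sqrt (hDpos (θ, φ)).le
    have hα' := quarticCircle_pos θ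
    have hv : value smoothPairQuartic ![A * Real.cos θ, A * Real.sin θ, B * Real.cos φ,
        B * Real.sin φ] = quarticCircle θ * A ^ 4 + quarticCircle φ * B ^ 4 - 3 * (A ^ 2 * B ^ 2) := by
      have e1 := Real.sin_sq_add_cos_sq θ
      have e2 := Real.sin_sq_add_cos_sq φ
      rw [value_smoothPairQuartic]
      simp only [quarticCircle, Matrix.cons_val]
      linear_combination -3 * A ^ 2 * B ^ 2 * (Real.sin φ ^ 2 + Real.cos φ ^ 2) * e1 -
        3 * A ^ 2 * B ^ 2 * e2
    simp only [hD] at hq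
    have hv' : value smoothPairQuartic ![A * Real.cos θ, A * Real.sin θ, B * Real.cos φ,
        B * Real.sin φ] = quarticCircle θ *
          ((A ^ 2 - (3 - √(D (θ, φ))) / (2 * quarticCircle θ) * B ^ 2) *
            (A ^ 2 - (3 + √(D (θ, φ))) / (2 * quarticCircle θ) * B ^ 2)) := by
      rw [hv]
      simp only [hD]
      set q := √(9 - 4 * (quarticCircle θ * quarticCircle φ))
      field_simp
      linear_combination B ^ 4 * hq
    rw [hv', mul_eq_zero, or_iff_right hα'.ne']
  · have hlt : (3 - √(D x)) / (2 * quarticCircle x.1) < 1 := by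
      rw [div_lt_one (hα x), sub_lt_comm]
      refine Real.lt_sqrt_of_sq_lt ?_
      have a1 := quarticCircle_pos x.1
      have a2 := quarticCircle_le_one x.1
      have a3 := quarticCircle_le_one x.2
      simp only [hD]
      nlinarith
    have hgt : 1 < (3 + √(D y)) / (2 * quarticCircle y.1) := by
      rw [one_lt_div (hα y)]
      have := Real.sqrt_nonneg (D y)
      have := quarticCircle_le_one y.1
      linarith
    exact Real.sqrt_lt_sqrt (hp2 x).le (hlt.trans hgt)

/-! ### Real loci: contractible tori -/

theorem ne_zero_of_sum_zero {x : Fin 4 → ℝ} (hx : x ≠ 0)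
    (h : x 0 = 0 → x 1 ^ 4 + x 2 ^ 4 + x 3 ^ 4 ≤ 0) : x 0 ≠ 0 := by
  intro h0
  have hle := h h0
  have h1 : 0 ≤ x 1 ^ 4 := by positivity
  have h2 : 0 ≤ x 2 ^ 4 := by positivity
  have h3 : 0 ≤ x 3 ^ 4 := by positivity
  have e1 : x 1 = 0 := pow_eq_zero_iff (n := 4) (by norm_num) |>.1 (by linarith)
  have e2 : x 2 = 0 := pow_eq_zero_iff (n := 4) (by norm_num) |>.1 (by linarith)
  have e3 : x 3 = 0 := pow_eq_zero_iff (n := 4) (by norm_num) |>.1 (by linarith)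
  refine hx (funext fun i => ?_)
  fin_cases i
  exacts [h0, e1, e2, e3]

theorem hasOneContractibleTorus_revolutionQuartic {ε : ℝ} (h0 : 0 < ε) (h1 : ε < 1) :
    HasOneContractibleTorus (revolutionQuartic ε) := by
  refine hasOneContractibleTorus_of_tube (α := fun _ => 1) (c := 1) (d := 1 - ε) contDiff_const
    (fun _ => rfl) (fun _ => one_pos) one_pos (by linarith) (fun _ => by linarith)
    (fun x hx hv => ne_zero_of_sum_zero hx fun hx0 => ?_) fun A θ w => ?_
  · rw [value_revolutionQuartic, hx0] at hv
    nlinarith [mul_nonneg (sq_nonneg (x 1)) (sq_nonneg (x 2))]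
  · rw [value_revolutionQuartic]
    simp only [Matrix.cons_val]
    have h2 : (A * Real.cos θ) ^ 2 + (A * Real.sin θ) ^ 2 = A ^ 2 := by
      linear_combination A ^ 2 * Real.sin_sq_add_cos_sq θ
    rw [h2]
    ring

theorem coord_ne_zero_of_smoothTubeQuartic_nonpos {x : Fin 4 → ℝ} (hx : x ≠ 0)
    (hv : value smoothTubeQuartic x ≤ 0) : x 0 ≠ 0 := by
  refine ne_zero_of_sum_zero hx fun hx0 => ?_
  rw [value_smoothTubeQuartic, hx0] at hv
  linarith

theorem hasOneContractibleTorus_smoothTubeQuartic :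
    HasOneContractibleTorus smoothTubeQuartic := by
  refine hasOneContractibleTorus_of_tube (c := 2) (d := 1) contDiff_quarticCircle
    quarticCircle_add_two_pi quarticCircle_pos two_pos one_pos
    (fun θ => by linarith [quarticCircle_le_one θ])
    (fun x hx hv => coord_ne_zero_of_smoothTubeQuartic_nonpos hx hv.le) fun A θ w => ?_
  rw [value_smoothTubeQuartic]
  simp only [Matrix.cons_val, quarticCircle]
  linear_combination -4 * A ^ 2 * Real.sin_sq_add_cos_sq θ

/-! ### Values of the invariants on the representatives -/

theorem hasAntipodalPath_neg_fermatQuartic : HasAntipodalPath (-fermatQuartic) := by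
  refine ⟨![0, 0, 1, 0], JoinedIn.ofLine
    (f := fun t : ℝ => ![0, 0, Real.cos (Real.pi * t), Real.sin (Real.pi * t)]) ?_ ?_ ?_ ?_⟩
  · refine Continuous.continuousOn (continuous_pi_iff.2 fun i => ?_)
    fin_cases i <;> simp <;> fun_prop
  · simp
  · simp
  · rintro _ ⟨t, -, rfl⟩
    have := quarticCircle_pos (Real.pi * t)
    rw [posSet, Set.mem_ofPred_eq, value_neg_quartic, value_fermatQuartic]
    simp only [Matrix.cons_val, quarticCircle] at this ⊢
    linarith

/-- On the diagonal circle the form equals `2(cos⁴ + sin⁴) - 3 < 0`, and half a turn is the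
antipodal map. -/
theorem hasAntipodalPath_neg_smoothPairQuartic : HasAntipodalPath (-smoothPairQuartic) := by
  refine ⟨![1, 0, 1, 0], JoinedIn.ofLine
    (f := fun t : ℝ => ![Real.cos (Real.pi * t), Real.sin (Real.pi * t), Real.cos (Real.pi * t),
      Real.sin (Real.pi * t)]) ?_ ?_ ?_ ?_⟩
  · refine Continuous.continuousOn (continuous_pi_iff.2 fun i => ?_)
    fin_cases i <;> simp <;> fun_prop
  · simp
  · simp
  · rintro _ ⟨t, -, rfl⟩
    have h1 := quarticCircle_le_one (Real.pi * t)
    have h2 : Real.cos (Real.pi * t) ^ 2 + Real.sin (Real.pi * t) ^ 2 = 1 :=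
      Real.cos_sq_add_sin_sq _
    rw [posSet, Set.mem_ofPred_eq, value_neg_quartic, value_smoothPairQuartic]
    simp only [Matrix.cons_val, quarticCircle, h2] at h1 ⊢
    linarith

/-- The coordinate `X₀` does not vanish on the negative cone, but would change sign along an
antipodal path. -/
theorem not_hasAntipodalPath_neg_smoothTubeQuartic : ¬ HasAntipodalPath (-smoothTubeQuartic) := by
  rintro ⟨x, γ, hγ⟩
  have hc : Continuous fun t => γ t 0 := (continuous_apply 0).comp γ.continuous
  have hne : ∀ t, γ t 0 ≠ 0 := fun t => by
    have hv := hγ t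
    have h0 := ne_zero_of_mem_posSet hv
    rw [posSet, Set.mem_ofPred_eq, value_neg_quartic] at hv
    exact coord_ne_zero_of_smoothTubeQuartic_nonpos h0 (by linarith)
  have hs : γ 0 0 = x 0 := by simp
  have ht : γ 1 0 = -x 0 := by simp
  obtain ⟨t, ht⟩ : (0 : ℝ) ∈ Set.range fun t => γ t 0 := by
    rcases le_total (x 0) 0 with h | h
    · exact mem_range_of_exists_le_of_exists_ge hc ⟨0, hs.trans_le h⟩ ⟨1, by linarith⟩
    · exact mem_range_of_exists_le_of_exists_ge hc ⟨1, by linarith⟩ ⟨0, h.trans_eq hs.symm⟩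
  exact hne t ht

theorem posConnected_fermatQuartic : PosConnected fermatQuartic := by
  have key : ∀ x ∈ posSet fermatQuartic, JoinedIn (posSet fermatQuartic) x ![1, 0, 0, 0] := by
    intro x hx
    rw [posSet, Set.mem_ofPred_eq, value_fermatQuartic] at hx
    obtain ⟨A, θ, hA, h0, h1⟩ := exists_polar (x 0) (x 1)
    have h2 : 0 ≤ x 2 ^ 4 := by positivity
    have h3 : 0 ≤ x 3 ^ 4 := by positivity
    have hA' : 0 < A := by
      refine lt_of_le_of_ne hA fun h => ?_
      rw [h0, h1, ← h] at hx
      linarith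
    -- Shrinking `X₂, X₃` can only increase the form; a rotation in the `X₀X₁`-plane and a rescaling
    -- then reach the base vector.
    have j1 : JoinedIn (posSet fermatQuartic) x ![x 0, x 1, 0, 0] := by
      refine JoinedIn.ofLine (f := fun t : ℝ => ![x 0, x 1, (1 - t) * x 2, (1 - t) * x 3])
        ?_ ?_ ?_ ?_
      · refine Continuous.continuousOn (continuous_pi_iff.2 fun i => ?_)
        fin_cases i <;> simp <;> fun_prop
      · ext i
        fin_cases i <;> simp
      · simp
      · rintro _ ⟨t, ht, rfl⟩
        have ht4 : (1 - t) ^ 4 ≤ 1 := pow_le_one₀ (by linarith [ht.2]) (by linarith [ht.1])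
        rw [posSet, Set.mem_ofPred_eq, value_fermatQuartic]
        simp only [Matrix.cons_val, mul_pow]
        have := mul_le_of_le_one_left h2 ht4
        have := mul_le_of_le_one_left h3 ht4
        linarith
    have j2 : JoinedIn (posSet fermatQuartic) ![x 0, x 1, 0, 0] ![A, 0, 0, 0] := by
      refine JoinedIn.ofLine (f := fun t : ℝ =>
        ![A * Real.cos ((1 - t) * θ), A * Real.sin ((1 - t) * θ), 0, 0]) ?_ ?_ ?_ ?_
      · refine Continuous.continuousOn (continuous_pi_iff.2 fun i => ?_)
        fin_cases i <;> simp <;> fun_prop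
      · simp [h0, h1]
      · simp
      · rintro _ ⟨t, -, rfl⟩
        have := mul_pos (pow_pos hA' 4) (quarticCircle_pos ((1 - t) * θ))
        rw [posSet, Set.mem_ofPred_eq, value_fermatQuartic]
        simp only [Matrix.cons_val, quarticCircle] at this ⊢
        linarith
    have j3 := joinedIn_smul j2.target_mem (inv_pos.2 hA')
    have : A⁻¹ • ![A, 0, 0, 0] = ![1, 0, 0, 0] := by simp [hA'.ne']
    rw [this] at j3
    exact j1.trans (j2.trans j3)
  exact fun x hx y hy => (key x hx).trans (key y hy).symm

/-- The hypersurface `X₀² + X₁² = X₂² + X₃²` separates the two chosen vectors. If `s` denotes the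
common value, the form there is at most `2s² - 3s² ≤ 0`. -/
theorem not_posConnected_smoothPairQuartic : ¬ PosConnected smoothPairQuartic := by
  intro h
  obtain ⟨γ, hγ⟩ := h ![1, 0, 0, 0] (by
      rw [posSet, Set.mem_ofPred_eq, value_smoothPairQuartic]; simp)
    ![0, 0, 1, 0] (by
      rw [posSet, Set.mem_ofPred_eq, value_smoothPairQuartic]; simp)
  have hγi : ∀ i, Continuous fun t => γ t i := fun i => (continuous_apply i).comp γ.continuous
  have hc : Continuous fun t => (γ t 0 ^ 2 + γ t 1 ^ 2) - (γ t 2 ^ 2 + γ t 3 ^ 2) :=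
    (((hγi 0).pow 2).add ((hγi 1).pow 2)).sub (((hγi 2).pow 2).add ((hγi 3).pow 2))
  obtain ⟨t, ht⟩ := mem_range_of_exists_le_of_exists_ge hc (c := 0)
    ⟨1, by simp⟩ ⟨0, by simp⟩
  have hv := hγ t
  rw [posSet, Set.mem_ofPred_eq, value_smoothPairQuartic] at hv
  simp only at ht
  nlinarith [mul_nonneg (sq_nonneg (γ t 0)) (sq_nonneg (γ t 1)),
    mul_nonneg (sq_nonneg (γ t 2)) (sq_nonneg (γ t 3)), sq_nonneg (γ t 2 ^ 2 + γ t 3 ^ 2)]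

/-! ### Complex singular loci of the two singular families -/

theorem disjoint_range_realPoints_of_forall {P : Quartic}
    (h : ∀ z : Fin 4 → ℂ, aeval z (P : MvPolynomial (Fin 4) ℝ) = 0 →
      (∀ i, aeval z (pderiv i (P : MvPolynomial (Fin 4) ℝ)) = 0) →
      ∀ (x : Fin 4 → ℝ) (a : ℂ), a • z = complexify x → x = 0) :
    Disjoint (Set.range realPoints) (singularLocus P) := by
  rw [Set.disjoint_left]
  rintro _ ⟨p, rfl⟩ ⟨z, hz, h0, h1, hp⟩
  induction p using Projectivization.ind with
  | h x hx =>
    rw [realPoints, Projectivization.map_mk, Projectivization.mk_eq_mk_iff'] at hp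
    obtain ⟨a, ha⟩ := hp
    exact hx (h z h0 h1 x a ha)

/-- Write `P = f₁f₂` with `fᵢ = z₀² + z₁² - rᵢ(z₂² + z₃²)`. If `z₂² + z₃² ≠ 0`, the factors differ
there, so exactly one vanishes and its `z₀`- and `z₁`-derivatives must vanish too. Then `z₀ = z₁ =
0`, contradicting `rᵢ ≠ 0`. -/
theorem productQuartic_singular_iff {r₁ r₂ : ℝ} (h₁ : 0 < r₁) (h₂ : r₁ < r₂) {z : Fin 4 → ℂ} :
    (aeval z (productQuartic r₁ r₂ : MvPolynomial (Fin 4) ℝ) = 0 ∧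
      ∀ i, aeval z (pderiv i (productQuartic r₁ r₂ : MvPolynomial (Fin 4) ℝ)) = 0) ↔
    z 0 ^ 2 + z 1 ^ 2 = 0 ∧ z 2 ^ 2 + z 3 ^ 2 = 0 := by
  constructor
  · rintro ⟨hP, h⟩
    have h0 := h 0
    have h1 := h 1
    simp [productQuartic, pderiv_X] at hP h0 h1
    have hne : (r₁ - r₂ : ℂ) ≠ 0 := by exact_mod_cast (sub_neg.2 h₂).ne
    have hr₁ : (r₁ : ℂ) ≠ 0 := by exact_mod_cast h₁.ne'
    have hr₂ : (r₂ : ℂ) ≠ 0 := by exact_mod_cast (h₁.trans h₂).ne'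
    have hB : z 2 ^ 2 + z 3 ^ 2 = 0 := by
      by_contra hB
      have hc : (r₁ - r₂ : ℂ) * (z 2 ^ 2 + z 3 ^ 2) ≠ 0 := mul_ne_zero hne hB
      rcases hP with hP | hP
      · have e0 : z 0 = 0 := (mul_eq_zero.1 (show (r₁ - r₂ : ℂ) * (z 2 ^ 2 + z 3 ^ 2) * z 0 = 0 by
          linear_combination h0 / 2 - 2 * z 0 * hP)).resolve_left hc
        have e1 : z 1 = 0 := (mul_eq_zero.1 (show (r₁ - r₂ : ℂ) * (z 2 ^ 2 + z 3 ^ 2) * z 1 = 0 by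
          linear_combination h1 / 2 - 2 * z 1 * hP)).resolve_left hc
        simp [e0, e1, hr₁, hB] at hP
      · have e0 : z 0 = 0 := (mul_eq_zero.1 (show (r₁ - r₂ : ℂ) * (z 2 ^ 2 + z 3 ^ 2) * z 0 = 0 by
          linear_combination -h0 / 2 + 2 * z 0 * hP)).resolve_left hc
        have e1 : z 1 = 0 := (mul_eq_zero.1 (show (r₁ - r₂ : ℂ) * (z 2 ^ 2 + z 3 ^ 2) * z 1 = 0 by
          linear_combination -h1 / 2 + 2 * z 1 * hP)).resolve_left hc
        simp [e0, e1, hr₂, hB] at hP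
    exact ⟨by simpa [hB] using hP, hB⟩
  · rintro ⟨hA, hB⟩
    refine ⟨by simp [productQuartic, hA, hB], fun i => ?_⟩
    fin_cases i <;> simp [productQuartic, pderiv_X, hA, hB]

/-- Let `g = z₁² + z₂² - z₀²`. If `g ≠ 0`, then `z₁ = z₂ = 0` and `∂₀P = 0` becomes `(1 - ε) z₀³ =
0`, forcing `g = 0` after all. With `g = 0`, the same equation becomes `ε z₀³ = 0`. -/
theorem revolutionQuartic_singular_iff {ε : ℝ} (h0 : 0 < ε) (h1 : ε < 1) {z : Fin 4 → ℂ} :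
    (aeval z (revolutionQuartic ε : MvPolynomial (Fin 4) ℝ) = 0 ∧
      ∀ i, aeval z (pderiv i (revolutionQuartic ε : MvPolynomial (Fin 4) ℝ)) = 0) ↔
    z 0 = 0 ∧ z 3 = 0 ∧ z 1 ^ 2 + z 2 ^ 2 = 0 := by
  constructor
  · rintro ⟨hP, h⟩
    have d0 := h 0
    have d1 := h 1
    have d2 := h 2
    have d3 := h 3
    simp [revolutionQuartic, pderiv_X] at d0 d1 d2 d3
    have hε : (ε : ℂ) ≠ 0 := by exact_mod_cast h0.ne'
    have hε' : (1 - ε : ℂ) ≠ 0 := by exact_mod_cast (sub_pos.2 h1).ne'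
    have hg : z 1 ^ 2 + z 2 ^ 2 - z 0 ^ 2 = 0 := by
      by_contra hg
      have e1 := d1.resolve_left hg
      have e2 := d2.resolve_left hg
      rw [e1, e2] at d0 hg
      have : (1 - ε : ℂ) * z 0 ^ 3 = 0 := by linear_combination d0 / 4
      have e0 := (mul_eq_zero.1 this).resolve_left hε'
      rw [pow_eq_zero_iff (by norm_num)] at e0
      simp [e0] at hg
    rw [hg] at d0
    have e0 : z 0 = 0 := by simpa [hε] using d0
    exact ⟨e0, d3, by simpa [e0] using hg⟩
  · rintro ⟨hz0, hz3, hA⟩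
    refine ⟨by simp [revolutionQuartic, hA, hz0, hz3], fun i => ?_⟩
    fin_cases i <;> simp [revolutionQuartic, pderiv_X, hA, hz0, hz3]

theorem exists_eq_I_mul {v w : ℂ} (h : v ^ 2 + w ^ 2 = 0) :
    ∃ m : Fin 2, w = (-1) ^ (m : ℕ) * Complex.I * v := by
  have : (w - Complex.I * v) * (w + Complex.I * v) = 0 := by
    linear_combination h - v ^ 2 * Complex.I_sq
  rcases mul_eq_zero.1 this with h | h
  · exact ⟨0, by simpa using sub_eq_zero.1 h⟩
  · exact ⟨1, by simpa using eq_neg_of_add_eq_zero_left h⟩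

theorem sq_add_I_mul_sq (m : Fin 2) (v : ℂ) :
    v ^ 2 + ((-1) ^ (m : ℕ) * Complex.I * v) ^ 2 = 0 := by
  rw [mul_pow, mul_pow, Complex.I_sq, ← pow_mul, mul_comm (m : ℕ), pow_mul]
  norm_num

theorem singularLocus_productQuartic {r₁ r₂ : ℝ} (h₁ : 0 < r₁) (h₂ : r₁ < r₂) :
    singularLocus (productQuartic r₁ r₂) = ⋃ m : Fin 2, ⋃ n : Fin 2, isotropicLine m n := by
  ext p
  simp only [Set.mem_iUnion]
  constructor
  · rintro ⟨z, hz, h0, h, rfl⟩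
    obtain ⟨hA, hB⟩ := (productQuartic_singular_iff h₁ h₂).1 ⟨h0, h⟩
    obtain ⟨m, hm⟩ := exists_eq_I_mul hA
    obtain ⟨n, hn⟩ := exists_eq_I_mul hB
    have hz' : z = ![z 0, (-1) ^ (m : ℕ) * Complex.I * z 0, z 2,
        (-1) ^ (n : ℕ) * Complex.I * z 2] := by
      ext i
      fin_cases i
      exacts [rfl, hm, rfl, hn]
    refine ⟨m, n, z 0, z 2, hz' ▸ hz, ?_⟩
    congr 1
  · rintro ⟨m, n, a, b, h, rfl⟩
    obtain ⟨h0, h1⟩ := (productQuartic_singular_iff h₁ h₂ (z := ![a, (-1) ^ (m : ℕ) * Complex.I * a,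
      b, (-1) ^ (n : ℕ) * Complex.I * b])).2 ⟨sq_add_I_mul_sq m a, sq_add_I_mul_sq n b⟩
    exact ⟨_, h, h0, h1, rfl⟩

theorem eq_zero_of_complex_sq_add_sq {x y : ℝ} (h : (x : ℂ) ^ 2 + (y : ℂ) ^ 2 = 0) :
    x = 0 ∧ y = 0 := by
  have h' : x ^ 2 + y ^ 2 = 0 := by exact_mod_cast h
  constructor <;> nlinarith [sq_nonneg x, sq_nonneg y]

theorem disjoint_singularLocus_productQuartic {r₁ r₂ : ℝ} (h₁ : 0 < r₁) (h₂ : r₁ < r₂) :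
    Disjoint (Set.range realPoints) (singularLocus (productQuartic r₁ r₂)) := by
  refine disjoint_range_realPoints_of_forall fun z h0 h x a ha => ?_
  obtain ⟨hA, hB⟩ := (productQuartic_singular_iff h₁ h₂).1 ⟨h0, h⟩
  have hx (i : Fin 4) : (x i : ℂ) = a * z i := (congrFun ha i).symm
  obtain ⟨e0, e1⟩ := eq_zero_of_complex_sq_add_sq (x := x 0) (y := x 1) (by
    rw [hx, hx]; linear_combination a ^ 2 * hA)
  obtain ⟨e2, e3⟩ := eq_zero_of_complex_sq_add_sq (x := x 2) (y := x 3) (by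
    rw [hx, hx]; linear_combination a ^ 2 * hB)
  ext i
  fin_cases i
  exacts [e0, e1, e2, e3]

theorem singularLocus_revolutionQuartic {ε : ℝ} (h0 : 0 < ε) (h1 : ε < 1) :
    singularLocus (revolutionQuartic ε) = {circularPoint 0, circularPoint 1} := by
  have hmem (p : CP3) : p ∈ ({circularPoint 0, circularPoint 1} : Set CP3) ↔
      ∃ m : Fin 2, p = circularPoint m := by
    simp [Fin.exists_fin_two]
  ext p
  rw [hmem]
  constructor
  · rintro ⟨z, hz, hP, h, rfl⟩
    obtain ⟨e0, e3, hA⟩ := (revolutionQuartic_singular_iff h0 h1).1 ⟨hP, h⟩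
    obtain ⟨m, hm⟩ := exists_eq_I_mul hA
    refine ⟨m, (Projectivization.mk_eq_mk_iff' ℂ _ _ _ _).2 ⟨z 1, ?_⟩⟩
    ext i
    fin_cases i
    · simp [e0]
    · simp
    · simp [hm]
      ring
    · simp [e3]
  · rintro ⟨m, rfl⟩
    have h' := sq_add_I_mul_sq m 1
    rw [mul_one] at h'
    obtain ⟨hP, hd⟩ := (revolutionQuartic_singular_iff h0 h1
      (z := ![0, 1, (-1) ^ (m : ℕ) * Complex.I, 0])).2 ⟨rfl, rfl, h'⟩
    exact ⟨_, _, hP, hd, rfl⟩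

theorem disjoint_singularLocus_revolutionQuartic {ε : ℝ} (h0 : 0 < ε) (h1 : ε < 1) :
    Disjoint (Set.range realPoints) (singularLocus (revolutionQuartic ε)) := by
  refine disjoint_range_realPoints_of_forall fun z hP h x a ha => ?_
  obtain ⟨e0, e3, hA⟩ := (revolutionQuartic_singular_iff h0 h1).1 ⟨hP, h⟩
  have hx (i : Fin 4) : (x i : ℂ) = a * z i := (congrFun ha i).symm
  obtain ⟨e1, e2⟩ := eq_zero_of_complex_sq_add_sq (x := x 1) (y := x 2) (by
    rw [hx, hx]; linear_combination a ^ 2 * hA)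
  have e0' : x 0 = 0 := by
    have := hx 0
    rw [e0, mul_zero] at this
    exact_mod_cast this
  have e3' : x 3 = 0 := by
    have := hx 3
    rw [e3, mul_zero] at this
    exact_mod_cast this
  ext i
  fin_cases i
  exacts [e0', e1, e2, e3']

/-! ### Separation of the components and conclusion -/

theorem hasAntipodalPath_neg_iff {P P' : Quartic} (hP : P ∈ smoothQuartics ∩ torusQuartics)
    (hP' : P' ∈ smoothQuartics ∩ torusQuartics)
    (h : connectedComponentIn (smoothQuartics ∩ torusQuartics) P =
      connectedComponentIn (smoothQuartics ∩ torusQuartics) P') :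
    HasAntipodalPath (-P) ↔ HasAntipodalPath (-P') :=
  iff_of_connectedComponentIn_eq (p := fun P => HasAntipodalPath (-P)) (fun _ hx =>
    continuous_neg_quartic.continuousAt.eventually
      (eventually_hasAntipodalPath_iff (realRegular_of_smooth hx.1).neg)) hP' hP h

theorem posConnected_iff {P P' : Quartic} (hP : P ∈ smoothQuartics ∩ torusQuartics)
    (hP' : P' ∈ smoothQuartics ∩ torusQuartics)
    (h : connectedComponentIn (smoothQuartics ∩ torusQuartics) P =
      connectedComponentIn (smoothQuartics ∩ torusQuartics) P') :
    PosConnected P ↔ PosConnected P' :=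
  iff_of_connectedComponentIn_eq (fun _ hx =>
    eventually_posConnected_iff (realRegular_of_smooth hx.1)) hP' hP h

end RealQuartics

theorem mainTheorem3 :
    (fermatQuartic ∈ smoothQuartics ∧ fermatQuartic ∈ torusQuartics ∧
      HasOneEssentialTorus fermatQuartic) ∧
    (∀ r₁ r₂ : ℝ, 0 < r₁ → r₁ < r₂ →
      productQuartic r₁ r₂ ∈ torusQuartics ∧
      HasTwoEssentialTori (productQuartic r₁ r₂) ∧
      singularLocus (productQuartic r₁ r₂) = ⋃ m : Fin 2, ⋃ n : Fin 2, isotropicLine m n ∧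
      Disjoint (Set.range realPoints) (singularLocus (productQuartic r₁ r₂))) ∧
    (∀ ε : ℝ, 0 < ε → ε < 1 →
      revolutionQuartic ε ∈ torusQuartics ∧
      HasOneContractibleTorus (revolutionQuartic ε) ∧
      singularLocus (revolutionQuartic ε) = {circularPoint 0, circularPoint 1} ∧
      Disjoint (Set.range realPoints) (singularLocus (revolutionQuartic ε))) ∧
    (∃ R ∈ smoothQuartics ∩ torusQuartics, ∃ Q ∈ smoothQuartics ∩ torusQuartics,
        HasTwoEssentialTori R ∧ HasOneContractibleTorus Q ∧
        connectedComponentIn (smoothQuartics ∩ torusQuartics) fermatQuartic ≠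
          connectedComponentIn (smoothQuartics ∩ torusQuartics) R ∧
        connectedComponentIn (smoothQuartics ∩ torusQuartics) fermatQuartic ≠
          connectedComponentIn (smoothQuartics ∩ torusQuartics) Q ∧
        connectedComponentIn (smoothQuartics ∩ torusQuartics) R ≠
          connectedComponentIn (smoothQuartics ∩ torusQuartics) Q) ∧
    3 ≤ ENat.card (ConnectedComponents ↥(smoothQuartics ∩ torusQuartics)) := by
  have hF : fermatQuartic ∈ smoothQuartics ∩ torusQuartics :=
    ⟨fermatQuartic_smooth, mem_torusQuartics_of_smooth hasOneEssentialTorus_fermatQuartic.1 le_rfl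
      fermatQuartic_smooth⟩
  have hR : smoothPairQuartic ∈ smoothQuartics ∩ torusQuartics := by
    obtain ⟨T₁, T₂, hT₁, -, -, hT, -⟩ := hasTwoEssentialTori_smoothPairQuartic
    exact ⟨smoothPairQuartic_smooth, mem_torusQuartics_of_smooth hT₁
      (hT ▸ Set.subset_union_left) smoothPairQuartic_smooth⟩
  have hQ : smoothTubeQuartic ∈ smoothQuartics ∩ torusQuartics :=
    ⟨smoothTubeQuartic_smooth, mem_torusQuartics_of_smooth
      hasOneContractibleTorus_smoothTubeQuartic.1 le_rfl smoothTubeQuartic_smooth⟩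
  -- Connectedness of the positive cone separates the two quartics with essential tori; antipodal
  -- paths in the negative cone separate each of them from the third.
  have hFR := fun h => not_posConnected_smoothPairQuartic
    ((posConnected_iff hF hR h).1 posConnected_fermatQuartic)
  have hFQ := fun h => not_hasAntipodalPath_neg_smoothTubeQuartic
    ((hasAntipodalPath_neg_iff hF hQ h).1 hasAntipodalPath_neg_fermatQuartic)
  have hRQ := fun h => not_hasAntipodalPath_neg_smoothTubeQuartic
    ((hasAntipodalPath_neg_iff hR hQ h).1 hasAntipodalPath_neg_smoothPairQuartic)
  refine ⟨⟨hF.1, hF.2, hasOneEssentialTorus_fermatQuartic⟩, fun r₁ r₂ h₁ h₂ => ?_,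
    fun ε h0 h1 => ?_, ?_, three_le_card_connectedComponents hF hR hQ hFR hFQ hRQ⟩
  · have hS := disjoint_singularLocus_productQuartic h₁ h₂
    have hT := hasTwoEssentialTori_productQuartic h₁ h₂
    refine ⟨?_, hT, singularLocus_productQuartic h₁ h₂, hS⟩
    obtain ⟨T₁, T₂, hT₁, -, -, hT, -⟩ := hT
    exact mem_torusQuartics hT₁ (hT ▸ Set.subset_union_left) hS
  · have hS := disjoint_singularLocus_revolutionQuartic h0 h1
    have hT := hasOneContractibleTorus_revolutionQuartic h0 h1
    exact ⟨mem_torusQuartics hT.1 le_rfl hS, hT, singularLocus_revolutionQuartic h0 h1, hS⟩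
  · exact ⟨_, hR, _, hQ, hasTwoEssentialTori_smoothPairQuartic,
      hasOneContractibleTorus_smoothTubeQuartic, hFR, hFQ, hRQ⟩
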